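/- Let $(\Omega,\mathcal F,\mathsf P)$ be an atomless probability space. Let $(\Psi_t)_{t\ge0}$ be a concave distortion semigroup: each $\Psi_t:[0,1]\to[0,1]$ is concave and increasing with $\Psi_t(0)=0$, $\Psi_t(1)=1$, one has $\Psi_s\circ\Psi_t=\Psi_{s+t}$ for all $s,t\ge0$, and the trivial families ($\Psi_t(x)=x$ for all $t\ge0$, $x\in[0,1]$; $\Psi_t(x)=1$ for all $t\ge0$, $x\in(0,1]$) are excluded. Suppose that $\Psi_t(0+)=0$ for every $t\ge0$. Define the generator by $G(x)=\lim_{t\downarrow0}(\Psi_t(x)-x)/t$ for $x\in(0,1)$ and $G(0)=G(1)=0$. Write $D_X$ for the distribution function of $X$, and use the convention $\infty-\infty=-\infty$ in expectations and integrals. Let $L^1(\alpha)$ be the set of random variables $X$ with $\int_{\mathbb R}x\,d(\Psi_t(D_X(x)))>-\infty$ and $\int_{\mathbb R}x\,d(\Psi_t(D_{-X}(x)))>-\infty$ for all $t\ge0$. For $t\ge 0$ let $\Phi_t(x)=\sup_{y\in[0,1]}[\Psi_t(y)-xy]$, and let $\mathcal D_t$ be the set of probability measures $\mathsf Q\ll\mathsf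 P$ with $\mathsf E(d\mathsf Q/d\mathsf P-x)^+\le\Phi_t(x)$ for all $x\ge0$. Then the limit defining $G(x)$ exists and is finite for every $x\in(0,1)$; for every $X\in L^1(\alpha)$ with a continuous distribution and every $t>0$ the set $\operatorname{argmin}_{\mathsf Q\in\mathcal D_t}\mathsf E_{\mathsf Q}X$ consists of exactly one measure, denoted $\mathsf Q_t^*(X)$; and the following conditions are equivalent: (a) for every $X\in L^1(\alpha)$ with a continuous distribution and every $t>0$, the density $d\mathsf Q_t^*(X)/d\mathsf P$ is (essentially) unbounded; (b) for every $t>0$, $\partial_x^+\Psi_t(0)=\infty$; (c) $G'_+(0)=\infty$. -/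

import Mathlib

open MeasureTheory ProbabilityTheory Filter Set Topology
open scoped NNReal ENNReal

namespace DistortionSemigroups

/-- A concave distortion: a concave increasing function `[0,1] → [0,1]` with `ψ 0 = 0`, `ψ 1 = 1`.
It is stored as a function on `ℝ`; its values outside `[0,1]` are never used. (That the values on
`[0,1]` lie in `[0,1]` follows from monotonicity and the two boundary values.) -/
structure ConcaveDistortion where
  toFun : ℝ → ℝ
  concave : ConcaveOn ℝ (Icc 0 1) toFun
  mono : MonotoneOn toFun (Icc 0 1)
  map_zero : toFun 0 = 0
  map_one : toFun 1 = 1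

instance : CoeFun ConcaveDistortion (fun _ => ℝ → ℝ) := ⟨ConcaveDistortion.toFun⟩

/-- A concave distortion semigroup `(Ψ_t)_{t ≥ 0}`: `Ψ_s ∘ Ψ_t = Ψ_{s+t}` on `[0,1]`, where the two
trivial families (`Ψ_t(x) = x` for all `t`, `x`, and `Ψ_t(x) = 1` for all `t` and `x ∈ (0,1]`)
are excluded. -/
structure IsDistortionSemigroup (Ψ : ℝ≥0 → ConcaveDistortion) : Prop where
  comp : ∀ s t : ℝ≥0, ∀ x ∈ Icc (0 : ℝ) 1, Ψ s (Ψ t x) = Ψ (s + t) x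
  ne_id : ∃ t : ℝ≥0, ∃ x ∈ Icc (0 : ℝ) 1, Ψ t x ≠ x
  ne_one : ∃ t : ℝ≥0, ∃ x ∈ Ioc (0 : ℝ) 1, Ψ t x ≠ 1

open Classical in
/-- The generator `G(x) = lim_{t ↓ 0} (Ψ_t(x) - x) / t` for `x ∈ (0,1)`, and
`G(0) = G(1) = 0` (the value `0` is also used outside `[0,1]`, where it is irrelevant). -/
noncomputable def generator (Ψ : ℝ≥0 → ConcaveDistortion) (x : ℝ) : ℝ :=
  if x ∈ Ioo (0 : ℝ) 1 then
    limUnder (𝓝[>] (0 : ℝ≥0)) (fun t : ℝ≥0 => (Ψ t x - x) / (t : ℝ))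
  else 0

/-- The right derivative of `f` at `a` exists in the extended sense and equals `+∞`. -/
def RightDerivEqTop (f : ℝ → ℝ) (a : ℝ) : Prop :=
  Tendsto (fun x => (f x - f a) / (x - a)) (𝓝[>] a) atTop

/-- A measure is atomless if every measurable set of positive measure has a measurable subset of
strictly smaller positive measure. -/
def Atomless {Ω : Type*} [MeasurableSpace Ω] (P : Measure Ω) : Prop :=
  ∀ A, MeasurableSet A → 0 < P A → ∃ B, MeasurableSet B ∧ B ⊆ A ∧ 0 < P B ∧ P B < P A

/-- The expectation `E_Q X = E_Q X⁺ - E_Q X⁻ ∈ [-∞, ∞]`, with the convention `∞ - ∞ = -∞`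
(this is the convention of `EReal`: `⊤ - ⊤ = ⊥`). -/
noncomputable def extExp {Ω : Type*} [MeasurableSpace Ω] (Q : Measure Ω) (X : Ω → ℝ) : EReal :=
  ((∫⁻ ω, ENNReal.ofReal (X ω) ∂Q : ℝ≥0∞) : EReal)
    - ((∫⁻ ω, ENNReal.ofReal (-X ω) ∂Q : ℝ≥0∞) : EReal)

/-- The composition of a concave distortion with a distribution function is increasing. -/
theorem ConcaveDistortion.monotone_comp_cdf (ψ : ConcaveDistortion) (μ : Measure ℝ) :
    Monotone (fun x => ψ (cdf μ x)) := fun _ _ h =>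
  ψ.mono ⟨cdf_nonneg μ _, cdf_le_one μ _⟩ ⟨cdf_nonneg μ _, cdf_le_one μ _⟩ (monotone_cdf μ h)

/-- The Lebesgue-Stieltjes measure `d(ψ(D(x)))` on `ℝ`, where `D` is the distribution function of
the probability measure `μ`. -/
noncomputable def distortedLaw (ψ : ConcaveDistortion) (μ : Measure ℝ) : Measure ℝ :=
  (ψ.monotone_comp_cdf μ).stieltjesFunction.measure

/-- The distorted expectation `∫ x d(ψ(D_X(x)))`, with values in `[-∞, ∞]` and the convention
`∞ - ∞ = -∞`. -/
noncomputable def distortedExp {Ω : Type*} [MeasurableSpace Ω] (P : Measure Ω)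
    (ψ : ConcaveDistortion) (X : Ω → ℝ) : EReal :=
  extExp (distortedLaw ψ (P.map X)) (fun x => x)

/-- The space `L¹(α)` of the acceptability index `α` associated with the family `(Ψ_t)`: all random
variables `X` such that the distorted expectations of `X` and of `-X` are `> -∞` for all `t`. -/
def L1Index {Ω : Type*} [MeasurableSpace Ω] (P : Measure Ω) (Ψ : ℝ≥0 → ConcaveDistortion) :
    Set (Ω → ℝ) :=
  {X | Measurable X ∧ ∀ t : ℝ≥0, ⊥ < distortedExp P (Ψ t) X ∧ ⊥ < distortedExp P (Ψ t) (-X)}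

/-- The conjugate `Φ(x) = sup_{y ∈ [0,1]} (ψ(y) - x y)`. -/
noncomputable def conjugate (ψ : ConcaveDistortion) (x : ℝ) : ℝ :=
  sSup ((fun y => ψ y - x * y) '' Icc (0 : ℝ) 1)

/-- The set `D` of the probability measures `Q ≪ P` such that
`E (dQ/dP - x)⁺ ≤ Φ(x)` for all `x ≥ 0`. The subtraction in `ℝ≥0∞` is truncated at zero, so
that it is the positive part. -/
noncomputable def determiningSet {Ω : Type*} [MeasurableSpace Ω] (P : Measure Ω)
    (ψ : ConcaveDistortion) : Set (Measure Ω) :=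
  {Q | IsProbabilityMeasure Q ∧ Q ≪ P ∧
    ∀ x : ℝ, 0 ≤ x →
      ∫⁻ ω, (Q.rnDeriv P ω - ENNReal.ofReal x) ∂P ≤ ENNReal.ofReal (conjugate ψ x)}

/-- The set `argmin_{Q ∈ D} E_Q X` of extreme measures. -/
def extremeMeasures {Ω : Type*} [MeasurableSpace Ω] (P : Measure Ω)
    (ψ : ConcaveDistortion) (X : Ω → ℝ) : Set (Measure Ω) :=
  {Q | Q ∈ determiningSet P ψ ∧ ∀ Q' ∈ determiningSet P ψ, extExp Q X ≤ extExp Q' X}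

/-- The density `dQ/dP` is (essentially) unbounded. -/
def UnboundedDensity {Ω : Type*} [MeasurableSpace Ω] (P Q : Measure Ω) : Prop :=
  ∀ M : ℝ≥0, 0 < P {ω | (M : ℝ≥0∞) < Q.rnDeriv P ω}

end DistortionSemigroups

/-! Slopes. For `x` in `(0,1)` the orbit `Ψ_t x` is a sum of increments `g_s(y) = Ψ_s y - y` taken
along it. Concavity makes `g_s(y)/y` decreasing and `g_s(y)/(1-y)` increasing, so each increment is
comparable with the first one, `g_s(x)`. Summing `t/s` of them (`increment_lower`,
`increment_upper`) shows that `g_s(x)/s` is nearly independent of `s`. This gives the generator, and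
the limit `s → 0` yields `t G(x) (1 - Ψ_t x) ≤ (Ψ_t x - x)(1 - x)` and `(Ψ_t x - x) x ≤ t G(x) Ψ_t
x`. Hence the slopes of `Ψ_t` and of `G` at the origin are infinite together, which is (b) ⇔ (c).

Extreme measures. Every `Q` in the determining set satisfies `Q A ≤ ψ(P A)`, so the law of `X` under
`Q` dominates the distorted law stochastically. The measure with density `ψ'(D_X(X))` belongs to the
set and attains the distorted law, hence minimises. Integrability forces every minimiser to attain
the same law (`eq_of_extExp_le`). Attainment on all the sets `{X ≤ a}` makes the conjugate
inequalities equalities and places the density on a known side of each level (`ae_threshold`), so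
the minimiser is unique.

Density. A bound `C` on the density of the extreme measure is the same as `ψ y ≤ C y`, that is, a
finite slope at the origin. For (a) ⇒ (b) some admissible `X` must exist; atomlessness supplies a
bounded one (`Atomless.exists_bounded_continuous_cdf`). -/

namespace DistortionSemigroups

/-! ### Elementary inequalities for a single concave distortion -/

namespace ConcaveDistortion

variable (ψ : ConcaveDistortion)

theorem map_mem_Icc {x : ℝ} (hx : x ∈ Icc (0 : ℝ) 1) : ψ x ∈ Icc (0 : ℝ) 1 :=
  ⟨ψ.map_zero ▸ ψ.mono ⟨le_rfl, zero_le_one⟩ hx hx.1,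
    ψ.map_one ▸ ψ.mono hx ⟨zero_le_one, le_rfl⟩ hx.2⟩

/-- The three-point form of concavity. -/
theorem three_point {a b c : ℝ} (ha : 0 ≤ a) (hab : a ≤ b) (hbc : b ≤ c) (hc : c ≤ 1) :
    ψ a * (c - b) + ψ c * (b - a) ≤ ψ b * (c - a) := by
  rcases hab.eq_or_lt with rfl | hab
  · simp
  rcases hbc.eq_or_lt with rfl | hbc
  · simp
  have h := ψ.concave.slope_anti_adjacent (x := a) (y := b) (z := c)
    ⟨ha, by linarith⟩ ⟨by linarith, hc⟩ hab hbc
  rw [div_le_div_iff₀ (by linarith) (by linarith)] at h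
  linarith

theorem le_map {x : ℝ} (hx : x ∈ Icc (0 : ℝ) 1) : x ≤ ψ x := by
  have := ψ.three_point le_rfl hx.1 hx.2 le_rfl
  simp only [ψ.map_zero, ψ.map_one] at this
  linarith

/-- `ψ x / x` is decreasing. -/
theorem map_mul_le {x y : ℝ} (hx : 0 ≤ x) (hxy : x ≤ y) (hy : y ≤ 1) : ψ y * x ≤ ψ x * y := by
  have := ψ.three_point le_rfl hx hxy hy
  simp only [ψ.map_zero] at this
  linarith

/-- `(ψ x - x) / x` is decreasing. -/
theorem sub_mul_le {x y : ℝ} (hx : 0 ≤ x) (hxy : x ≤ y) (hy : y ≤ 1) :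
    (ψ y - y) * x ≤ (ψ x - x) * y := by
  have := ψ.map_mul_le hx hxy hy
  linarith

/-- `(ψ x - x) / (1 - x)` is increasing. -/
theorem sub_mul_one_sub_le {x y : ℝ} (hx : 0 ≤ x) (hxy : x ≤ y) (hy : y ≤ 1) :
    (ψ x - x) * (1 - y) ≤ (ψ y - y) * (1 - x) := by
  have := ψ.three_point hx hxy hy le_rfl
  simp only [ψ.map_one] at this
  nlinarith

theorem continuousOn (h : Tendsto (fun x : ℝ => ψ x) (𝓝[>] 0) (𝓝 0)) :
    ContinuousOn ψ (Icc 0 1) := by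
  intro x hx
  rcases hx.1.eq_or_lt with rfl | h0
  · have : ContinuousWithinAt ψ (Ioi 0) 0 := by simpa [ContinuousWithinAt, ψ.map_zero] using h
    exact (continuousWithinAt_Ioi_iff_Ici.1 this).mono Icc_subset_Ici_self
  rcases hx.2.eq_or_lt with rfl | h1
  · refine tendsto_of_tendsto_of_tendsto_of_le_of_le' (g := id) (h := fun _ => (1 : ℝ))
      ?_ (by rw [ψ.map_one]; exact tendsto_const_nhds) ?_ ?_
    · rw [ψ.map_one]; exact tendsto_id.mono_left nhdsWithin_le_nhds
    · filter_upwards [self_mem_nhdsWithin] with y hy using ψ.le_map hy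
    · filter_upwards [self_mem_nhdsWithin] with y hy using (ψ.map_mem_Icc hy).2
  · have := ψ.concave.continuousOn_interior
    rw [interior_Icc] at this
    exact ((this x ⟨h0, h1⟩).continuousAt (Ioo_mem_nhds h0 h1)).continuousWithinAt

/-- A decreasing ratio `f x / x` either tends to infinity at the origin or is bounded. The dichotomy
serves both the distortions and the generator. -/
theorem rightDerivEqTop_or_bounded (f : ℝ → ℝ) (h0 : f 0 = 0)
    (hf : ∀ x y : ℝ, 0 < x → x ≤ y → y < 1 → f y * x ≤ f x * y) :
    RightDerivEqTop f 0 ∨ ∃ C : ℝ, 0 < C ∧ ∀ x ∈ Ioo (0 : ℝ) 1, f x ≤ C * x := by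
  refine or_iff_not_imp_left.2 fun h => ?_
  simp only [RightDerivEqTop, h0, sub_zero, tendsto_atTop, not_forall, not_eventually,
    not_le] at h
  obtain ⟨C, hC⟩ := h
  refine ⟨max C 1, by positivity, fun x hx => ?_⟩
  obtain ⟨y, hy, hy1, hy2⟩ := (hC.and_eventually (Ioo_mem_nhdsGT hx.1)).exists
  rw [div_lt_iff₀ hy1] at hy
  have h1 := hf y x hy1 hy2.le hx.2
  have h2 : f x * y ≤ C * x * y := by nlinarith [hx.1]
  have h3 := le_of_mul_le_mul_right h2 hy1
  exact h3.trans (mul_le_mul_of_nonneg_right (le_max_left _ _) hx.1.le)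

theorem not_bounded_of_rightDerivEqTop {f : ℝ → ℝ} (h0 : f 0 = 0) (h : RightDerivEqTop f 0)
    (C : ℝ) : ∃ x ∈ Ioo (0 : ℝ) 1, C * x < f x := by
  simp only [RightDerivEqTop, h0, sub_zero] at h
  obtain ⟨x, hx, hx1⟩ := ((h.eventually_gt_atTop C).and (Ioo_mem_nhdsGT one_pos)).exists
  exact ⟨x, hx1, (lt_div_iff₀ hx1.1).1 hx⟩

end ConcaveDistortion

theorem generator_zero (Ψ : ℝ≥0 → ConcaveDistortion) : generator Ψ 0 = 0 := if_neg (by simp)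

/-! ### Orbits of the semigroup and the generator -/

namespace IsDistortionSemigroup

variable {Ψ : ℝ≥0 → ConcaveDistortion} (hΨ : IsDistortionSemigroup Ψ)
include hΨ

theorem monotone_time {s t : ℝ≥0} (h : s ≤ t) {x : ℝ} (hx : x ∈ Icc (0 : ℝ) 1) :
    Ψ s x ≤ Ψ t x := by
  obtain ⟨r, rfl⟩ := exists_add_of_le h
  rw [add_comm, ← hΨ.comp r s x hx]
  exact (Ψ r).le_map ((Ψ s).map_mem_Icc hx)

/-- `Ψ 0` is idempotent, and by continuity it is onto `[0,1]`; an idempotent surjection is the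
identity. -/
theorem map_zero_time (hzero : ∀ t : ℝ≥0, Tendsto (fun x : ℝ => Ψ t x) (𝓝[>] 0) (𝓝 0))
    {x : ℝ} (hx : x ∈ Icc (0 : ℝ) 1) : Ψ 0 x = x := by
  have hc := (Ψ 0).continuousOn (hzero 0)
  have := intermediate_value_Icc zero_le_one hc
  rw [(Ψ 0).map_zero, (Ψ 0).map_one] at this
  obtain ⟨y, hy, rfl⟩ := this hx
  simpa using hΨ.comp 0 0 y hy

/-- Each of the `n` increments along the orbit is at least `g_s(x) (1 - y) / (1 - x)` at its base
point `y`, and `1 - y` is smallest at the end of the orbit. -/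
theorem mul_sub_mul_le (hzero : ∀ t : ℝ≥0, Tendsto (fun x : ℝ => Ψ t x) (𝓝[>] 0) (𝓝 0))
    {x : ℝ} (hx : x ∈ Icc (0 : ℝ) 1) (s : ℝ≥0) (n : ℕ) :
    n * (Ψ s x - x) * (1 - Ψ (n * s) x) ≤ (Ψ (n * s) x - x) * (1 - x) := by
  induction n with
  | zero => simp [hΨ.map_zero_time hzero hx]
  | succ n ih =>
    have hy := (Ψ (n * s)).map_mem_Icc hx
    have hg := (Ψ s).le_map hx
    have hxy := (Ψ (n * s)).le_map hx
    have h1 := (Ψ s).sub_mul_one_sub_le hx.1 hxy hy.2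
    have h2 := (Ψ s).le_map hy
    have h3 : Ψ ((n + 1 : ℕ) * s) x = Ψ s (Ψ (n * s) x) := by
      rw [hΨ.comp _ _ x hx]; congr 2; push_cast; ring
    rw [h3]
    push_cast
    have h4 : 0 ≤ ((n : ℝ) + 1) * (Ψ s x - x) := mul_nonneg (by positivity) (by linarith)
    have h5 := mul_le_mul_of_nonneg_left (sub_le_sub_left h2 1) h4
    linarith

/-- Each increment is at most `g_s(x) y / x`. The last of the `n + 1` base points is the one at time
`n s`, which `increment_upper` can keep below `t`. -/
theorem sub_mul_le_mul (hzero : ∀ t : ℝ≥0, Tendsto (fun x : ℝ => Ψ t x) (𝓝[>] 0) (𝓝 0))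
    {x : ℝ} (hx : x ∈ Icc (0 : ℝ) 1) (s : ℝ≥0) (n : ℕ) :
    (Ψ ((n + 1) * s) x - x) * x ≤ (n + 1) * (Ψ s x - x) * Ψ (n * s) x := by
  induction n with
  | zero => simp [hΨ.map_zero_time hzero hx]
  | succ n ih =>
    push_cast
    have hy := (Ψ ((n + 1) * s)).map_mem_Icc hx
    have hg := (Ψ s).le_map hx
    have hxy := (Ψ ((n + 1) * s)).le_map hx
    have h1 := (Ψ s).sub_mul_le hx.1 hxy hy.2
    have h3 : Ψ ((n + 1 + 1) * s) x = Ψ s (Ψ ((n + 1) * s) x) := by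
      rw [hΨ.comp _ _ x hx]; congr 2; ring
    have h2 : Ψ (n * s) x ≤ Ψ ((n + 1) * s) x :=
      hΨ.monotone_time (mul_le_mul_left (by simp) _) hx
    rw [h3]
    have h4 : 0 ≤ ((n : ℝ) + 1) * (Ψ s x - x) := mul_nonneg (by positivity) (by linarith)
    have h5 := mul_le_mul_of_nonneg_left h2 h4
    linarith

/-- Rounding `t` to a multiple of `s` costs at most one step, whence the factor `t - s` here and `t
+ s` in the upper bound. -/
theorem increment_lower (hzero : ∀ t : ℝ≥0, Tendsto (fun x : ℝ => Ψ t x) (𝓝[>] 0) (𝓝 0))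
    {x : ℝ} (hx : x ∈ Icc (0 : ℝ) 1) {s : ℝ≥0} (hs : 0 < s) (t : ℝ≥0) :
    (t - s) * (Ψ s x - x) * (1 - Ψ t x) ≤ s * ((Ψ t x - x) * (1 - x)) := by
  set n := ⌊t / s⌋₊ with hn
  have h1 : n * s ≤ t := (le_div_iff₀ hs).1 (Nat.floor_le (zero_le))
  have h2 : t < (n + 1) * s := (div_lt_iff₀ hs).1 (Nat.lt_floor_add_one _)
  have h3 := hΨ.mul_sub_mul_le hzero hx s n
  have h4 := hΨ.monotone_time h1 hx
  have h5 := ((Ψ t).map_mem_Icc hx).2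
  have h6 := (Ψ s).le_map hx
  have h2' : (t : ℝ) < (n + 1) * s := by exact_mod_cast h2
  have hs' : (0 : ℝ) < s := hs
  calc (t - s) * (Ψ s x - x) * (1 - Ψ t x) ≤ (n * s) * (Ψ s x - x) * (1 - Ψ t x) := by
        gcongr; linarith
    _ = s * (n * (Ψ s x - x) * (1 - Ψ t x)) := by ring
    _ ≤ s * (n * (Ψ s x - x) * (1 - Ψ (n * s) x)) := by
        have : 0 ≤ (n : ℝ) * (Ψ s x - x) := mul_nonneg (by positivity) (by linarith)
        gcongr
    _ ≤ s * ((Ψ (n * s) x - x) * (1 - x)) := by gcongr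
    _ ≤ s * ((Ψ t x - x) * (1 - x)) := by
        have := hx.2
        gcongr

theorem increment_upper (hzero : ∀ t : ℝ≥0, Tendsto (fun x : ℝ => Ψ t x) (𝓝[>] 0) (𝓝 0))
    {x : ℝ} (hx : x ∈ Icc (0 : ℝ) 1) {s : ℝ≥0} (hs : 0 < s) (t : ℝ≥0) :
    s * ((Ψ t x - x) * x) ≤ (t + s) * (Ψ s x - x) * Ψ t x := by
  set n := ⌊t / s⌋₊ with hn
  have h1 : n * s ≤ t := (le_div_iff₀ hs).1 (Nat.floor_le (zero_le))
  have h2 : t < (n + 1) * s := (div_lt_iff₀ hs).1 (Nat.lt_floor_add_one _)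
  have h3 := hΨ.sub_mul_le_mul hzero hx s n
  have h4 := hΨ.monotone_time h1 hx
  have h5 := ((Ψ t).map_mem_Icc hx).1
  have h6 := (Ψ s).le_map hx
  have h7 := hΨ.monotone_time h2.le hx
  have h1' : (n : ℝ) * s ≤ t := by exact_mod_cast h1
  have hs' : (0 : ℝ) < s := hs
  have h8 : 0 ≤ ((n : ℝ) + 1) * (Ψ s x - x) := mul_nonneg (by positivity) (by linarith)
  calc s * ((Ψ t x - x) * x) ≤ s * ((Ψ ((n + 1) * s) x - x) * x) := by
        have := hx.1
        gcongr
    _ ≤ s * ((n + 1) * (Ψ s x - x) * Ψ (n * s) x) := by gcongr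
    _ ≤ s * ((n + 1) * (Ψ s x - x) * Ψ t x) := by gcongr
    _ = (n * s + s) * (Ψ s x - x) * Ψ t x := by ring
    _ ≤ (t + s) * (Ψ s x - x) * Ψ t x := by
        gcongr

/-- Right continuity in time at the origin. -/
theorem tendsto_time_zero (hzero : ∀ t : ℝ≥0, Tendsto (fun x : ℝ => Ψ t x) (𝓝[>] 0) (𝓝 0))
    {x : ℝ} (hx : x ∈ Ioo (0 : ℝ) 1) : Tendsto (fun t => Ψ t x) (𝓝[>] 0) (𝓝 x) := by
  have hx' := Ioo_subset_Icc_self hx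
  refine tendsto_order.2 ⟨fun a ha => Eventually.of_forall fun t => ha.trans_le ((Ψ t).le_map hx'),
    fun b hb => ?_⟩
  have hex : ∃ s : ℝ≥0, 0 < s ∧ Ψ s x < b := by
    by_contra! hcon
    -- A jump at `x` at arbitrarily small times forces a jump of at least `(b - x) y` at every `y ≤
    -- x`. Splitting time `1` into `n` steps, each starting with such a jump, drives `y` to `1`,
    -- against `Ψ_1(0+) = 0`.
    have hone : ∀ y ∈ Ioc (0 : ℝ) x, Ψ 1 y = 1 := by
      intro y hy
      have hy' : y ∈ Icc (0 : ℝ) 1 := ⟨hy.1.le, hy.2.trans hx.2.le⟩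
      refine le_antisymm ((Ψ 1).map_mem_Icc hy').2 ?_
      by_contra! hlt
      set ε := (b - x) * y with hε
      have hε0 : 0 < ε := mul_pos (by linarith) hy.1
      have hjump : ∀ s : ℝ≥0, 0 < s → ε ≤ Ψ s y - y := by
        intro s hs
        have h1 := (Ψ s).sub_mul_le hy.1.le hy.2 hx.2.le
        have h2 := hcon s hs
        have h3 := (Ψ s).le_map hy'
        have h4 : (b - x) * y ≤ (Ψ s x - x) * y :=
          mul_le_mul_of_nonneg_right (by linarith) hy.1.le
        have h5 : (Ψ s y - y) * x ≤ (Ψ s y - y) * 1 :=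
          mul_le_mul_of_nonneg_left hx.2.le (by linarith)
        linarith
      have hpos : 0 < ε * (1 - Ψ 1 y) := mul_pos hε0 (by linarith)
      obtain ⟨n, hn⟩ := exists_nat_gt (1 / (ε * (1 - Ψ 1 y)))
      rw [div_lt_iff₀ hpos] at hn
      have hn0 : 0 < n := by
        rcases Nat.eq_zero_or_pos n with rfl | h
        · norm_num at hn
        · exact h
      have hs : (0 : ℝ≥0) < (n : ℝ≥0)⁻¹ := by positivity
      have h1 := hΨ.mul_sub_mul_le hzero hy' ((n : ℝ≥0)⁻¹) n
      rw [mul_inv_cancel₀ (by positivity)] at h1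
      have h2 := hjump _ hs
      have h3 : (n : ℝ) * ε * (1 - Ψ 1 y) ≤ n * (Ψ (n : ℝ≥0)⁻¹ y - y) * (1 - Ψ 1 y) := by
        gcongr
      have h4 : (Ψ 1 y - y) * (1 - y) ≤ 1 := by
        have := (Ψ 1).map_mem_Icc hy'
        nlinarith [this.1, this.2, hy'.1, hy'.2]
      linarith
    have h1 := (hzero 1).eventually_lt_const (zero_lt_one)
    obtain ⟨y, hy1, hy2⟩ := (h1.and (Ioc_mem_nhdsGT hx.1)).exists
    exact hy1.ne (hone y hy2)
  obtain ⟨s, hs, hsb⟩ := hex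
  filter_upwards [Ioc_mem_nhdsGT hs] with t ht
  exact (hΨ.monotone_time ht.2 hx').trans_lt hsb

/-- With `q t = (Ψ_t x - x)/t` and `c t = (1 - Ψ_t x)/(1 - x) → 1`, the limit is the infimum of
`q/c`. That infimum bounds the lower limit of `q` since `c → 1`; `hkey` bounds the upper limit by
every value of `q/c`. -/
theorem exists_tendsto_generator
    (hzero : ∀ t : ℝ≥0, Tendsto (fun x : ℝ => Ψ t x) (𝓝[>] 0) (𝓝 0))
    {x : ℝ} (hx : x ∈ Ioo (0 : ℝ) 1) :
    ∃ L : ℝ, Tendsto (fun t : ℝ≥0 => (Ψ t x - x) / (t : ℝ)) (𝓝[>] 0) (𝓝 L) := by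
  have hx' := Ioo_subset_Icc_self hx
  have hx1 : 0 < 1 - x := by linarith [hx.2]
  set q : ℝ≥0 → ℝ := fun t => (Ψ t x - x) / t with hq
  set c : ℝ≥0 → ℝ := fun t => (1 - Ψ t x) / (1 - x) with hc
  set S : Set ℝ := (fun t => q t / c t) '' {t : ℝ≥0 | 0 < t ∧ Ψ t x < 1} with hS
  have hq0 : ∀ t, 0 ≤ q t := fun t => div_nonneg (by linarith [(Ψ t).le_map hx']) t.2
  have hc0 : ∀ t, 0 ≤ c t := fun t =>
    div_nonneg (by linarith [((Ψ t).map_mem_Icc hx').2]) hx1.le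
  have hlim := hΨ.tendsto_time_zero hzero hx
  have hev : ∀ᶠ t in 𝓝[>] (0 : ℝ≥0), 0 < t ∧ Ψ t x < 1 :=
    (eventually_mem_nhdsWithin).and (hlim.eventually_lt_const hx.2)
  have hSne : S.Nonempty := by
    obtain ⟨t, ht⟩ := hev.exists
    exact ⟨_, t, ht, rfl⟩
  have hSbdd : BddBelow S := ⟨0, by
    rintro _ ⟨t, -, rfl⟩
    exact div_nonneg (hq0 t) (hc0 t)⟩
  have hclim : Tendsto c (𝓝[>] 0) (𝓝 1) := by
    have := (hlim.const_sub 1).div_const (1 - x)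
    rwa [div_self hx1.ne'] at this
  have hkey : ∀ s t : ℝ≥0, 0 < s → 0 < t → q s * (1 - s / t) * c t ≤ q t := by
    intro s t hs ht
    have h := hΨ.increment_lower hzero hx' hs t
    have hs' : (0 : ℝ) < s := hs
    have ht' : (0 : ℝ) < t := ht
    simp only [hq, hc]
    rw [le_div_iff₀ ht', one_sub_div ht'.ne']
    have h' : (t - s : ℝ) * (Ψ s x - x) * (1 - Ψ t x) / (s * (1 - x)) ≤ Ψ t x - x := by
      rw [div_le_iff₀ (by positivity)]; linarith
    refine le_trans (le_of_eq ?_) h'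
    field_simp
  refine ⟨sInf S, tendsto_order.2 ⟨fun a ha => ?_, fun b hb => ?_⟩⟩
  · have h1 : Tendsto (fun t => sInf S * c t) (𝓝[>] 0) (𝓝 (sInf S)) := by
      simpa using hclim.const_mul (sInf S)
    filter_upwards [h1.eventually_const_lt ha, hev] with t h ht
    refine h.trans_le ?_
    have hct : 0 < c t := div_pos (by linarith [ht.2]) hx1
    exact (le_div_iff₀ hct).1 (csInf_le hSbdd ⟨t, ht, rfl⟩)
  · obtain ⟨_, ⟨t, ht, rfl⟩, htb⟩ := exists_lt_of_csInf_lt hSne hb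
    have hct : 0 < c t := div_pos (by linarith [ht.2]) hx1
    have h1 : Tendsto (fun s : ℝ≥0 => b * (1 - (s : ℝ) / t)) (𝓝[>] 0) (𝓝 b) := by
      have : Continuous fun s : ℝ≥0 => b * (1 - (s : ℝ) / t) := by fun_prop
      simpa using (this.tendsto 0).mono_left nhdsWithin_le_nhds
    filter_upwards [h1.eventually_const_lt htb, Ioo_mem_nhdsGT ht.1] with s h hs
    have hst : 0 < 1 - (s : ℝ) / t := by
      have : (s : ℝ) / t < 1 := (div_lt_one (by exact_mod_cast ht.1)).2 (by exact_mod_cast hs.2)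
      linarith
    have h2 : q s * (1 - s / t) ≤ q t / c t := (le_div_iff₀ hct).2 (hkey s t hs.1 ht.1)
    exact lt_of_mul_lt_mul_right (h2.trans_lt h) hst.le

theorem tendsto_generator (hzero : ∀ t : ℝ≥0, Tendsto (fun x : ℝ => Ψ t x) (𝓝[>] 0) (𝓝 0))
    {x : ℝ} (hx : x ∈ Ioo (0 : ℝ) 1) :
    Tendsto (fun t : ℝ≥0 => (Ψ t x - x) / (t : ℝ)) (𝓝[>] 0) (𝓝 (generator Ψ x)) := by
  obtain ⟨L, hL⟩ := hΨ.exists_tendsto_generator hzero hx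
  rw [generator, if_pos hx, hL.limUnder_eq]
  exact hL

theorem generator_mul_le (hzero : ∀ t : ℝ≥0, Tendsto (fun x : ℝ => Ψ t x) (𝓝[>] 0) (𝓝 0))
    {x y : ℝ} (hx : 0 < x) (hxy : x ≤ y) (hy : y < 1) :
    generator Ψ y * x ≤ generator Ψ x * y := by
  have h1 := (hΨ.tendsto_generator hzero ⟨hx.trans_le hxy, hy⟩).mul_const x
  have h2 := (hΨ.tendsto_generator hzero ⟨hx, hxy.trans_lt hy⟩).mul_const y
  refine le_of_tendsto_of_tendsto' h1 h2 fun t => ?_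
  rw [div_mul_eq_mul_div, div_mul_eq_mul_div]
  exact div_le_div_of_nonneg_right ((Ψ t).sub_mul_le hx.le hxy hy.le) t.2

theorem generator_lower (hzero : ∀ t : ℝ≥0, Tendsto (fun x : ℝ => Ψ t x) (𝓝[>] 0) (𝓝 0))
    {x : ℝ} (hx : x ∈ Ioo (0 : ℝ) 1) (t : ℝ≥0) :
    t * generator Ψ x * (1 - Ψ t x) ≤ (Ψ t x - x) * (1 - x) := by
  have h1 : Tendsto (fun s : ℝ≥0 => ((t : ℝ) - s) * ((Ψ s x - x) / s) * (1 - Ψ t x)) (𝓝[>] 0)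
      (𝓝 (((t : ℝ) - (0 : ℝ≥0)) * generator Ψ x * (1 - Ψ t x))) := by
    have : Continuous fun s : ℝ≥0 => (t : ℝ) - s := by fun_prop
    exact (((this.tendsto 0).mono_left nhdsWithin_le_nhds).mul
      (hΨ.tendsto_generator hzero hx)).mul_const _
  simp only [NNReal.coe_zero, sub_zero] at h1
  refine le_of_tendsto h1 ?_
  filter_upwards [self_mem_nhdsWithin] with s hs
  have hs' : (0 : ℝ) < s := hs
  have h := hΨ.increment_lower hzero (Ioo_subset_Icc_self hx) hs t
  rw [← mul_div_assoc, div_mul_eq_mul_div, div_le_iff₀ hs']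
  linarith

theorem generator_upper (hzero : ∀ t : ℝ≥0, Tendsto (fun x : ℝ => Ψ t x) (𝓝[>] 0) (𝓝 0))
    {x : ℝ} (hx : x ∈ Ioo (0 : ℝ) 1) (t : ℝ≥0) :
    (Ψ t x - x) * x ≤ t * generator Ψ x * Ψ t x := by
  have h1 : Tendsto (fun s : ℝ≥0 => ((t : ℝ) + s) * ((Ψ s x - x) / s) * Ψ t x) (𝓝[>] 0)
      (𝓝 (((t : ℝ) + (0 : ℝ≥0)) * generator Ψ x * Ψ t x)) := by
    have : Continuous fun s : ℝ≥0 => (t : ℝ) + s := by fun_prop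
    exact (((this.tendsto 0).mono_left nhdsWithin_le_nhds).mul
      (hΨ.tendsto_generator hzero hx)).mul_const _
  simp only [NNReal.coe_zero, add_zero] at h1
  refine ge_of_tendsto h1 ?_
  filter_upwards [self_mem_nhdsWithin] with s hs
  have hs' : (0 : ℝ) < s := hs
  have h := hΨ.increment_upper hzero (Ioo_subset_Icc_self hx) hs t
  rw [← mul_div_assoc, div_mul_eq_mul_div, le_div_iff₀ hs']
  linarith

/-- All distortions have infinite slope at the origin iff the generator has. -/
theorem rightDerivEqTop_iff
    (hzero : ∀ t : ℝ≥0, Tendsto (fun x : ℝ => Ψ t x) (𝓝[>] 0) (𝓝 0)) :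
    (∀ t : ℝ≥0, 0 < t → RightDerivEqTop (Ψ t) 0) ↔ RightDerivEqTop (generator Ψ) 0 := by
  constructor
  · intro h
    refine (ConcaveDistortion.rightDerivEqTop_or_bounded _ (generator_zero Ψ) fun x y =>
      hΨ.generator_mul_le hzero).resolve_right ?_
    rintro ⟨C, hC, hG⟩
    -- With `t C = 1/2` the upper estimate reads `Ψ_t x - x ≤ Ψ_t x / 2`, hence `Ψ_t x ≤ 2 x`.
    set t : ℝ≥0 := ⟨1 / (2 * C), by positivity⟩
    have htC : (t : ℝ) * C = 1 / 2 := by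
      have : (t : ℝ) = 1 / (2 * C) := rfl
      rw [this]; field_simp
    have ht0 : 0 < t := by
      rw [← NNReal.coe_pos]; exact div_pos one_pos (by positivity)
    obtain ⟨x, hx, hlt⟩ :=
      ConcaveDistortion.not_bounded_of_rightDerivEqTop (Ψ t).map_zero (h t ht0) 2
    have h1 := hΨ.generator_upper hzero hx t
    have h2 := ((Ψ t).map_mem_Icc (Ioo_subset_Icc_self hx)).1
    have h3 : t * generator Ψ x * Ψ t x ≤ t * (C * x) * Ψ t x := by
      gcongr
      exact hG x hx
    have h4 : (t : ℝ) * (C * x) * Ψ t x = 1 / 2 * (x * Ψ t x) := by rw [← htC]; ring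
    have h5 : (Ψ t x) * x ≤ (2 * x) * x := by nlinarith
    exact absurd (le_of_mul_le_mul_right h5 hx.1) (not_le.2 hlt)
  · intro h t ht
    have ht' : (0 : ℝ) < t := ht
    have h' : Tendsto (fun x => generator Ψ x / x) (𝓝[>] 0) atTop := by
      simpa [RightDerivEqTop, generator_zero Ψ] using h
    simp only [RightDerivEqTop, (Ψ t).map_zero, sub_zero]
    -- Near the origin `Ψ_t x < 1/2`, and the lower estimate gives `t G(x) / 2 ≤ Ψ_t x`.
    refine tendsto_atTop_mono' _ ?_ (h'.const_mul_atTop (half_pos ht'))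
    filter_upwards [Ioo_mem_nhdsGT one_pos, (hzero t).eventually_lt_const (half_pos one_pos),
      h'.eventually_ge_atTop 0] with x hx hxt hG
    have h1 := hΨ.generator_lower hzero hx t
    have h2 := (Ψ t).le_map (Ioo_subset_Icc_self hx)
    have hG0 : 0 ≤ generator Ψ x := by
      by_contra! hneg
      exact absurd hG (not_le.2 (div_neg_of_neg_of_pos hneg hx.1))
    rw [← mul_div_assoc]
    refine div_le_div_of_nonneg_right ?_ hx.1.le
    have h3 : (t : ℝ) * generator Ψ x * (1 / 2) ≤ t * generator Ψ x * (1 - Ψ t x) := by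
      gcongr
      linarith
    have h4 : (Ψ t x - x) * (1 - x) ≤ (Ψ t x - x) * 1 :=
      mul_le_mul_of_nonneg_left (by linarith [hx.1]) (by linarith)
    linarith [hx.1]

end IsDistortionSemigroup
-- Right derivative and conjugate of a distortion
namespace ConcaveDistortion

variable (ψ : ConcaveDistortion)

/-- The right derivative of a concave distortion. -/
noncomputable def rightSlope (u : ℝ) : ℝ := derivWithin ψ (Ioi u) u

theorem measurable_rightSlope : Measurable ψ.rightSlope := measurable_derivWithin_Ioi _

theorem hasDerivWithinAt_rightSlope {u : ℝ} (hu : u ∈ Ioo (0 : ℝ) 1) :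
    HasDerivWithinAt ψ (ψ.rightSlope u) (Ioi u) u := by
  have h := (ψ.concave.neg.hasDerivWithinAt_rightDeriv_of_mem_interior
    (by rwa [interior_Icc] : u ∈ interior (Icc (0 : ℝ) 1))).neg
  rw [neg_neg] at h
  exact h.differentiableWithinAt.hasDerivWithinAt

/-- The right derivative is a supergradient. -/
theorem map_le_tangent {u y : ℝ} (hu : u ∈ Ioo (0 : ℝ) 1) (hy : y ∈ Icc (0 : ℝ) 1) :
    ψ y ≤ ψ u + ψ.rightSlope u * (y - u) := by
  have hd := ψ.hasDerivWithinAt_rightSlope hu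
  rcases lt_trichotomy u y with h | rfl | h
  · have := ψ.concave.slope_le_of_hasDerivWithinAt_Ioi (Ioo_subset_Icc_self hu) hy h hd
    rw [slope_def_field, div_le_iff₀ (by linarith)] at this
    linarith
  · simp
  · have hlim := (hasDerivWithinAt_iff_tendsto_slope' (by simp)).1 hd
    have : ψ.rightSlope u ≤ (ψ u - ψ y) / (u - y) := by
      refine le_of_tendsto hlim ?_
      filter_upwards [Ioo_mem_nhdsGT hu.2] with z hz
      rw [slope_def_field]
      exact ψ.concave.slope_anti_adjacent hy ⟨hu.1.le.trans hz.1.le, hz.2.le⟩ h hz.1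
    rw [le_div_iff₀ (by linarith)] at this
    linarith

theorem rightSlope_nonneg {u : ℝ} (hu : u ∈ Ioo (0 : ℝ) 1) : 0 ≤ ψ.rightSlope u := by
  have h := ψ.map_le_tangent hu (y := 1) ⟨zero_le_one, le_rfl⟩
  have h1 := (ψ.map_mem_Icc (Ioo_subset_Icc_self hu)).2
  rw [ψ.map_one] at h
  by_contra! hneg
  have := mul_neg_of_neg_of_pos hneg (by linarith [hu.2] : (0 : ℝ) < 1 - u)
  linarith

/-- The supremum in the definition of the conjugate is attained. -/
theorem exists_conjugate_eq (h0 : Tendsto (fun x : ℝ => ψ x) (𝓝[>] 0) (𝓝 0)) (x : ℝ) :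
    ∃ p ∈ Icc (0 : ℝ) 1, conjugate ψ x = ψ p - x * p ∧
      ∀ y ∈ Icc (0 : ℝ) 1, ψ y - x * y ≤ ψ p - x * p := by
  have hc : ContinuousOn (fun y => ψ y - x * y) (Icc 0 1) :=
    (ψ.continuousOn h0).sub (by fun_prop)
  obtain ⟨p, hp, hmax⟩ := isCompact_Icc.exists_isMaxOn (nonempty_Icc.2 zero_le_one) hc
  refine ⟨p, hp, ?_, fun y hy => hmax hy⟩
  refine IsLUB.csSup_eq ⟨?_, fun b hb => hb ⟨p, hp, rfl⟩⟩ ⟨_, p, hp, rfl⟩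
  rintro _ ⟨y, hy, rfl⟩
  exact hmax hy

theorem conjugate_rightSlope_le {p : ℝ} (hp : p ∈ Ioo (0 : ℝ) 1) :
    conjugate ψ (ψ.rightSlope p) ≤ ψ p - ψ.rightSlope p * p := by
  refine csSup_le ((nonempty_Icc.2 zero_le_one).image _) ?_
  rintro _ ⟨y, hy, rfl⟩
  have := ψ.map_le_tangent hp hy
  simp only
  linarith

theorem le_rightSlope_of_lt {x p u : ℝ} (hp : p ∈ Icc (0 : ℝ) 1)
    (hmax : ∀ y ∈ Icc (0 : ℝ) 1, ψ y - x * y ≤ ψ p - x * p) (hu : u ∈ Ioo (0 : ℝ) 1)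
    (hup : u < p) : x ≤ ψ.rightSlope u := by
  have h1 := ψ.map_le_tangent hu hp
  have h2 := hmax u (Ioo_subset_Icc_self hu)
  have h3 : x * (p - u) ≤ ψ.rightSlope u * (p - u) := by linarith
  exact le_of_mul_le_mul_right h3 (by linarith)

theorem rightSlope_le_of_lt {x p u : ℝ} (hp : p ∈ Icc (0 : ℝ) 1)
    (hmax : ∀ y ∈ Icc (0 : ℝ) 1, ψ y - x * y ≤ ψ p - x * p) (hu : u ∈ Ioo (0 : ℝ) 1)
    (hup : p < u) : ψ.rightSlope u ≤ x := by
  have h1 := ψ.map_le_tangent hu hp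
  have h2 := hmax u (Ioo_subset_Icc_self hu)
  have h3 : ψ.rightSlope u * (u - p) ≤ x * (u - p) := by linarith
  exact le_of_mul_le_mul_right h3 (by linarith)

/-- The slope may blow up at `0`, but it is nonnegative and `ψ` is continuous there, so it is
integrable and no mass is lost. -/
theorem lintegral_rightSlope (h0 : Tendsto (fun x : ℝ => ψ x) (𝓝[>] 0) (𝓝 0)) {p : ℝ}
    (hp : p ∈ Icc (0 : ℝ) 1) :
    ∫⁻ u in Ioo 0 p, ENNReal.ofReal (ψ.rightSlope u) = ENNReal.ofReal (ψ p) := by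
  have hsub : Ioo 0 p ⊆ Ioo (0 : ℝ) 1 := Ioo_subset_Ioo_right hp.2
  have hc : ContinuousOn ψ (Icc 0 p) := (ψ.continuousOn h0).mono (Icc_subset_Icc_right hp.2)
  have hd : ∀ x ∈ Ioo 0 p, HasDerivWithinAt ψ (ψ.rightSlope x) (Ioi x) x :=
    fun x hx => ψ.hasDerivWithinAt_rightSlope (hsub hx)
  have hi := intervalIntegral.integrableOn_deriv_right_of_nonneg hc hd
    fun x hx => ψ.rightSlope_nonneg (hsub hx)
  have h := intervalIntegral.integral_eq_sub_of_hasDeriv_right_of_le hp.1 hc hd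
    ((intervalIntegrable_iff_integrableOn_Ioc_of_le hp.1).2 hi)
  rw [intervalIntegral.integral_of_le hp.1, ψ.map_zero, sub_zero, integral_Ioc_eq_integral_Ioo] at h
  rw [← h, ofReal_integral_eq_lintegral_ofReal (hi.mono_set Ioo_subset_Ioc_self)]
  filter_upwards [ae_restrict_mem measurableSet_Ioo] with x hx
  exact ψ.rightSlope_nonneg (hsub hx)

end ConcaveDistortion

/-- The probability integral transform. -/
theorem map_cdf_eq_uniform (μ : Measure ℝ) [IsProbabilityMeasure μ] (hμ : Continuous (cdf μ)) :
    μ.map (cdf μ) = volume.restrict (Ioo 0 1) := by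
  have hm : Measurable (cdf μ) := hμ.measurable
  have : IsProbabilityMeasure (μ.map (cdf μ)) := Measure.isProbabilityMeasure_map hm.aemeasurable
  have hlevel : ∀ p ∈ Ioo (0 : ℝ) 1, ∃ a, cdf μ a = p := by
    intro p hp
    exact mem_range_of_exists_le_of_exists_ge hμ
      ((tendsto_cdf_atBot μ).eventually_le_const hp.1).exists
      ((tendsto_cdf_atTop μ).eventually_const_le hp.2).exists
  have hle : ∀ p ∈ Ioo (0 : ℝ) 1, ENNReal.ofReal p ≤ μ {x | cdf μ x ≤ p} := by
    intro p hp
    obtain ⟨a, rfl⟩ := hlevel p hp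
    rw [ofReal_cdf]
    exact measure_mono fun x hx => monotone_cdf μ hx
  have hlt : ∀ p ∈ Ioo (0 : ℝ) 1, μ {x | cdf μ x < p} ≤ ENNReal.ofReal p := by
    intro p hp
    obtain ⟨a, rfl⟩ := hlevel p hp
    rw [ofReal_cdf]
    exact measure_mono fun x hx => ((monotone_cdf μ).reflect_lt hx).le
  -- On a plateau at height `p` this set exceeds `Iic a`, so the bound comes from strict sublevel
  -- sets at `q ↓ p`.
  have hge : ∀ p : ℝ, 0 ≤ p → p < 1 → μ {x | cdf μ x ≤ p} ≤ ENNReal.ofReal p := by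
    intro p hp hp1
    have hlim : Tendsto ENNReal.ofReal (𝓝[>] p) (𝓝 (ENNReal.ofReal p)) :=
      (ENNReal.continuous_ofReal.tendsto p).mono_left nhdsWithin_le_nhds
    refine ge_of_tendsto hlim ?_
    filter_upwards [Ioo_mem_nhdsGT hp1] with q hq
    exact (measure_mono fun x (hx : cdf μ x ≤ p) => hx.trans_lt hq.1).trans
      (hlt q ⟨hp.trans_lt hq.1, hq.2⟩)
  refine Measure.ext_of_Iic _ _ fun p => ?_
  rw [Measure.map_apply hm measurableSet_Iic, Measure.restrict_apply measurableSet_Iic]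
  change μ {x | cdf μ x ≤ p} = _
  rcases lt_or_ge p 0 with h | h
  · have h1 : {x | cdf μ x ≤ p} = ∅ := by
      ext x; simpa using h.trans_le (cdf_nonneg μ x)
    have h2 : Iic p ∩ Ioo 0 1 = ∅ := by
      ext x; simp only [mem_inter_iff, mem_Iic, mem_Ioo, mem_empty_iff_false, iff_false]
      intro hx; linarith [hx.1, hx.2.1]
    simp [h1, h2]
  rcases lt_or_ge p 1 with h1 | h1
  · have h2 : Iic p ∩ Ioo 0 1 = Ioc 0 p := by
      ext x; simp only [mem_inter_iff, mem_Iic, mem_Ioo, mem_Ioc]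
      exact ⟨fun hx => ⟨hx.2.1, hx.1⟩, fun hx => ⟨hx.2, hx.1, hx.2.trans_lt h1⟩⟩
    rw [h2, Real.volume_Ioc, sub_zero]
    refine le_antisymm (hge p h h1) ?_
    rcases h.eq_or_lt with rfl | h
    · simp
    · exact hle p ⟨h, h1⟩
  · have h2 : Iic p ∩ Ioo 0 1 = Ioo 0 1 := by
      refine inter_eq_right.2 fun x hx => hx.2.le.trans h1
    have h3 : {x | cdf μ x ≤ p} = univ := by
      ext x; simpa using (cdf_le_one μ x).trans h1
    simp [h2, h3]

/-! ### Densities in the determining set -/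

section Measure

variable {Ω : Type*} [MeasurableSpace Ω] {P : Measure Ω} [IsProbabilityMeasure P]

/-- Measures of the determining set are dominated by the distorted probability. -/
theorem measure_le_of_mem_determiningSet {ψ : ConcaveDistortion} {Q : Measure Ω}
    (hQ : Q ∈ determiningSet P ψ) {A : Set Ω} (hA : MeasurableSet A) :
    Q A ≤ ENNReal.ofReal (ψ (P.real A)) := by
  obtain ⟨hprob, hac, hineq⟩ := hQ
  have hp0 : 0 ≤ P.real A := measureReal_nonneg
  have hp1 : P.real A ≤ 1 := measureReal_le_one
  rcases hp0.eq_or_lt with h | h0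
  · rw [hac ((measureReal_eq_zero_iff).1 h.symm)]
    exact zero_le
  rcases hp1.eq_or_lt with h | h1
  · rw [h, ψ.map_one, ENNReal.ofReal_one]
    exact prob_le_one
  have hk := ψ.rightSlope_nonneg ⟨h0, h1⟩
  -- Integrate `Z ≤ (Z - x)⁺ + x` over `A`. A supergradient at `P A` is the level for which `Φ(x) +
  -- x P(A)` is at most `ψ(P A)`.
  set x := ψ.rightSlope (P.real A) with hx
  calc Q A = ∫⁻ ω in A, Q.rnDeriv P ω ∂P := by
        conv_lhs => rw [← Measure.withDensity_rnDeriv_eq Q P hac, withDensity_apply _ hA]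
    _ ≤ ∫⁻ ω in A, ((Q.rnDeriv P ω - ENNReal.ofReal x) + ENNReal.ofReal x) ∂P :=
        lintegral_mono fun ω => le_tsub_add
    _ = ∫⁻ ω in A, (Q.rnDeriv P ω - ENNReal.ofReal x) ∂P + ENNReal.ofReal x * P A := by
        rw [lintegral_add_right _ measurable_const, setLIntegral_const]
    _ ≤ ENNReal.ofReal (conjugate ψ x) + ENNReal.ofReal x * P A := by
        gcongr
        exact (setLIntegral_le_lintegral _ _).trans (hineq x hk)
    _ ≤ ENNReal.ofReal (ψ (P.real A) - x * P.real A) + ENNReal.ofReal (x * P.real A) := by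
        rw [ENNReal.ofReal_mul hk, ofReal_measureReal]
        gcongr
        exact ψ.conjugate_rightSlope_le ⟨h0, h1⟩
    _ = ENNReal.ofReal (ψ (P.real A)) := by
        have h2 : 0 ≤ ψ (P.real A) - x * P.real A := by
          have := ψ.map_le_tangent ⟨h0, h1⟩ (y := 0) ⟨le_rfl, zero_le_one⟩
          rw [ψ.map_zero] at this
          linarith
        rw [← ENNReal.ofReal_add h2 (mul_nonneg hk hp0), sub_add_cancel]

/-- A set on which the distorted probability is attained separates the values of the density. -/
theorem ae_threshold {ψ : ConcaveDistortion} {Q : Measure Ω}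
    (hQ : Q ∈ determiningSet P ψ) {x p : ℝ} (hx : 0 ≤ x) (hp : p ∈ Icc (0 : ℝ) 1)
    (hconj : conjugate ψ x = ψ p - x * p) (hmax : ∀ y ∈ Icc (0 : ℝ) 1, ψ y - x * y ≤ ψ p - x * p)
    {A : Set Ω} (hA : MeasurableSet A) (hPA : P A = ENNReal.ofReal p)
    (hQA : Q A = ENNReal.ofReal (ψ p)) :
    ∀ᵐ ω ∂P, (ω ∈ A → ENNReal.ofReal x ≤ Q.rnDeriv P ω) ∧
      (ω ∉ A → Q.rnDeriv P ω ≤ ENNReal.ofReal x) := by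
  obtain ⟨hprob, hac, hineq⟩ := hQ
  have hconj0 : 0 ≤ ψ p - x * p := by
    have := hmax 0 ⟨le_rfl, zero_le_one⟩
    simpa [ψ.map_zero] using this
  set Z := Q.rnDeriv P with hZ
  have hZm : Measurable Z := Measure.measurable_rnDeriv _ _
  set c := ENNReal.ofReal x with hc
  -- Thus `Q A ≤ ∫_A (Z - x)⁺ + x P(A) ≤ Φ(x) + x P(A)` consists of equalities: the first gives `Z ≥
  -- x` on `A`, the second leaves `(Z - x)⁺` no mass off `A`.
  have hsplit : ENNReal.ofReal (ψ p) = ENNReal.ofReal (conjugate ψ x) + c * P A := by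
    rw [hPA, hc, ← ENNReal.ofReal_mul hx, hconj, ← ENNReal.ofReal_add hconj0 (mul_nonneg hx hp.1),
      sub_add_cancel]
  have hQint : ∫⁻ ω in A, Z ω ∂P = Q A := by
    conv_rhs => rw [← Measure.withDensity_rnDeriv_eq Q P hac, withDensity_apply _ hA]
  have hfin : c * P A ≠ ∞ := ENNReal.mul_ne_top ENNReal.ofReal_ne_top (measure_ne_top _ _)
  have hmid : ∫⁻ ω in A, ((Z ω - c) + c) ∂P = ∫⁻ ω in A, (Z ω - c) ∂P + c * P A := by
    rw [lintegral_add_right _ measurable_const, setLIntegral_const]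
  have htot := hineq x hx
  have hA_le : ∫⁻ ω in A, (Z ω - c) ∂P ≤ ENNReal.ofReal (conjugate ψ x) :=
    (setLIntegral_le_lintegral _ _).trans htot
  have hle : ∫⁻ ω in A, Z ω ∂P ≤ ∫⁻ ω in A, ((Z ω - c) + c) ∂P :=
    lintegral_mono fun ω => le_tsub_add
  have hon : ∀ᵐ ω ∂P, ω ∈ A → c ≤ Z ω := by
    have h : Z =ᵐ[P.restrict A] fun ω => (Z ω - c) + c := by
      refine ae_eq_of_ae_le_of_lintegral_le (Eventually.of_forall fun ω => le_tsub_add) ?_ ?_ ?_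
      · rw [hQint]; exact measure_ne_top _ _
      · exact ((hZm.sub_const c).add_const c).aemeasurable
      · rw [hmid, hQint, hQA, hsplit]; gcongr
    filter_upwards [(ae_restrict_iff' hA).1 h] with ω hω hωA
    rw [hω hωA]
    exact le_add_self
  have hA_eq : ENNReal.ofReal (conjugate ψ x) ≤ ∫⁻ ω in A, (Z ω - c) ∂P := by
    rw [hmid, hQint, hQA, hsplit] at hle
    exact (ENNReal.add_le_add_iff_right hfin).1 hle
  have hoff : ∀ᵐ ω ∂P, ω ∈ Aᶜ → Z ω - c = 0 := by
    rw [← setLIntegral_eq_zero_iff hA.compl (hZm.sub_const c)]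
    have h1 := lintegral_add_compl (μ := P) (fun ω => Z ω - c) hA
    have h2 : ∫⁻ ω in A, (Z ω - c) ∂P + ∫⁻ ω in Aᶜ, (Z ω - c) ∂P
        ≤ ∫⁻ ω in A, (Z ω - c) ∂P + 0 := by
      rw [h1, add_zero]; exact htot.trans hA_eq
    have h3 := (ENNReal.add_le_add_iff_left (hA_le.trans_lt ENNReal.ofReal_lt_top).ne).1 h2
    exact le_antisymm h3 zero_le
  filter_upwards [hon, hoff] with ω h1 h2
  exact ⟨h1, fun h => tsub_eq_zero_iff_le.1 (h2 h)⟩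

/-- Two measures of the determining set attaining the distorted probability along a common family
of sets coincide. -/
theorem eq_of_attain {ψ : ConcaveDistortion}
    (h0 : Tendsto (fun x : ℝ => ψ x) (𝓝[>] 0) (𝓝 0)) {Q Q' : Measure Ω}
    (hQ : Q ∈ determiningSet P ψ) (hQ' : Q' ∈ determiningSet P ψ)
    (h : ∀ p ∈ Icc (0 : ℝ) 1, ∃ A, MeasurableSet A ∧ P A = ENNReal.ofReal p ∧
      Q A = ENNReal.ofReal (ψ p) ∧ Q' A = ENNReal.ofReal (ψ p)) : Q = Q' := by
  have hprob := hQ.1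
  have hprob' := hQ'.1
  -- Both densities are at least `q` on the same set and at most `q` off it, so no rational level
  -- separates them.
  have key : ∀ q : ℚ, 0 ≤ q → ∀ᵐ ω ∂P, ∀ Z ∈ ({Q.rnDeriv P ω, Q'.rnDeriv P ω} : Set ℝ≥0∞),
      ∀ Z' ∈ ({Q.rnDeriv P ω, Q'.rnDeriv P ω} : Set ℝ≥0∞),
      Z < ENNReal.ofReal q → ¬ ENNReal.ofReal q < Z' := by
    intro q hq
    obtain ⟨p, hp, hconj, hmax⟩ := ψ.exists_conjugate_eq h0 q
    obtain ⟨A, hA, hPA, hQA, hQA'⟩ := h p hp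
    have hq' : (0 : ℝ) ≤ q := by exact_mod_cast hq
    filter_upwards [ae_threshold hQ hq' hp hconj hmax hA hPA hQA,
      ae_threshold hQ' hq' hp hconj hmax hA hPA hQA'] with ω h1 h2 Z hZ Z' hZ' hlt hlt'
    by_cases hω : ω ∈ A
    · rcases hZ with rfl | rfl
      · exact absurd (h1.1 hω) (not_le.2 hlt)
      · exact absurd (h2.1 hω) (not_le.2 hlt)
    · rcases hZ' with rfl | rfl
      · exact absurd (h1.2 hω) (not_le.2 hlt')
      · exact absurd (h2.2 hω) (not_le.2 hlt')
  have hae : Q.rnDeriv P =ᵐ[P] Q'.rnDeriv P := by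
    have hall : ∀ᵐ ω ∂P, ∀ q : ℚ, 0 ≤ q → ∀ Z ∈ ({Q.rnDeriv P ω, Q'.rnDeriv P ω} : Set ℝ≥0∞),
        ∀ Z' ∈ ({Q.rnDeriv P ω, Q'.rnDeriv P ω} : Set ℝ≥0∞),
        Z < ENNReal.ofReal q → ¬ ENNReal.ofReal q < Z' :=
      ae_all_iff.2 fun q => by
        by_cases hq : 0 ≤ q
        · filter_upwards [key q hq] with ω hω _ using hω
        · exact Eventually.of_forall fun ω hq' => absurd hq' hq
    filter_upwards [hall] with ω hω
    refine le_antisymm ?_ ?_ <;>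
    · by_contra! hlt
      obtain ⟨q, hq, hq1, hq2⟩ := ENNReal.lt_iff_exists_rat_btwn.1 hlt
      exact hω q hq _ (by simp) _ (by simp) hq1 hq2
  rw [← Measure.withDensity_rnDeriv_eq Q P hQ.2.1, ← Measure.withDensity_rnDeriv_eq Q' P hQ'.2.1]
  exact withDensity_congr_ae hae

omit [IsProbabilityMeasure P] in
/-- A bound `ψ y ≤ C y` excludes unbounded densities in the determining set. -/
theorem not_unboundedDensity_of_bounded {ψ : ConcaveDistortion} {C : ℝ≥0}
    (hC : ∀ y ∈ Icc (0 : ℝ) 1, ψ y ≤ C * y) {Q : Measure Ω} (hQ : Q ∈ determiningSet P ψ) :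
    ¬ UnboundedDensity P Q := by
  intro h
  have hprob := hQ.1
  -- The constraint at level `C` then says that `(Z - C)⁺` has zero integral.
  have hconj : conjugate ψ C ≤ 0 := by
    refine csSup_le ((nonempty_Icc.2 zero_le_one).image _) ?_
    rintro _ ⟨y, hy, rfl⟩
    have := hC y hy
    simp only
    linarith
  have h1 := hQ.2.2 C C.2
  rw [ENNReal.ofReal_of_nonpos hconj, nonpos_iff_eq_zero,
    lintegral_eq_zero_iff ((Measure.measurable_rnDeriv _ _).sub_const _)] at h1
  refine (h C).ne' ?_
  rw [← nonpos_iff_eq_zero, ← ae_iff.1 h1]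
  refine measure_mono fun ω hω => ?_
  simpa only [mem_ofPred_eq, Pi.zero_apply, tsub_eq_zero_iff_le, ENNReal.ofReal_coe_nnreal,
    not_le] using hω

/-- A measure attaining the distorted probability along a family of sets has an unbounded density
when the distortion has infinite slope at the origin. -/
theorem unboundedDensity_of_attain {ψ : ConcaveDistortion} (hψ : RightDerivEqTop ψ 0)
    {Q : Measure Ω} [IsProbabilityMeasure Q] (hac : Q ≪ P)
    (h : ∀ p ∈ Icc (0 : ℝ) 1, ∃ A, MeasurableSet A ∧ P A = ENNReal.ofReal p ∧
      Q A = ENNReal.ofReal (ψ p)) : UnboundedDensity P Q := by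
  intro M
  rw [pos_iff_ne_zero]
  intro hM
  obtain ⟨p, hp, hlt⟩ := ConcaveDistortion.not_bounded_of_rightDerivEqTop ψ.map_zero hψ M
  obtain ⟨A, hA, hPA, hQA⟩ := h p (Ioo_subset_Icc_self hp)
  have hae : ∀ᵐ ω ∂P, Q.rnDeriv P ω ≤ M := by
    rw [ae_iff]; simpa only [not_le] using hM
  have h1 : Q A ≤ M * P A := by
    calc Q A = ∫⁻ ω in A, Q.rnDeriv P ω ∂P := by
          conv_lhs => rw [← Measure.withDensity_rnDeriv_eq Q P hac, withDensity_apply _ hA]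
      _ ≤ ∫⁻ ω in A, (M : ℝ≥0∞) ∂P := lintegral_mono_ae (ae_restrict_of_ae hae)
      _ = M * P A := setLIntegral_const _ _
  rw [hPA, hQA, ← ENNReal.ofReal_coe_nnreal, ← ENNReal.ofReal_mul M.coe_nonneg,
    ENNReal.ofReal_le_ofReal_iff (mul_nonneg M.coe_nonneg hp.1.le)] at h1
  linarith

end Measure
-- Stochastic order and means of laws on the line
section Law

theorem lintegral_ofReal_eq_meas_Ioi (ρ : Measure ℝ) :
    ∫⁻ x, ENNReal.ofReal x ∂ρ = ∫⁻ t in Ioi 0, ρ (Ioi t) := by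
  have h := lintegral_eq_lintegral_meas_lt ρ (f := fun x : ℝ => max x 0)
    (Eventually.of_forall fun x => le_max_right _ _) (by fun_prop)
  have h1 : ∀ x : ℝ, ENNReal.ofReal (max x 0) = ENNReal.ofReal x := fun x => by
    rcases le_total x 0 with h | h
    · simp [h, ENNReal.ofReal_of_nonpos h]
    · simp [h]
  simp only [h1] at h
  rw [h]
  refine setLIntegral_congr_fun measurableSet_Ioi fun t (ht : 0 < t) => ?_
  congr 1
  ext x
  simp [ht.not_gt]

theorem lintegral_ofReal_neg_eq_meas_Iic (ρ : Measure ℝ) :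
    ∫⁻ x, ENNReal.ofReal (-x) ∂ρ = ∫⁻ t in Ioi 0, ρ (Iic (-t)) := by
  have h := lintegral_eq_lintegral_meas_le ρ (f := fun x : ℝ => max (-x) 0)
    (Eventually.of_forall fun x => le_max_right _ _) (by fun_prop)
  have h1 : ∀ x : ℝ, ENNReal.ofReal (max (-x) 0) = ENNReal.ofReal (-x) := fun x => by
    rcases le_total (-x) 0 with h | h
    · rw [max_eq_right h, ENNReal.ofReal_of_nonpos h, ENNReal.ofReal_zero]
    · rw [max_eq_left h]
  simp only [h1] at h
  rw [h]
  refine setLIntegral_congr_fun measurableSet_Ioi fun t (ht : 0 < t) => ?_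
  congr 1
  ext x
  simp [ht.not_ge, le_neg]

theorem extExp_map {Ω : Type*} [MeasurableSpace Ω] (Q : Measure Ω) {X : Ω → ℝ}
    (hX : Measurable X) : extExp (Q.map X) (fun x => x) = extExp Q X := by
  unfold extExp
  rw [lintegral_map (by fun_prop) hX, lintegral_map (by fun_prop) hX]

variable {ρ ν : Measure ℝ} [IsProbabilityMeasure ρ] [IsProbabilityMeasure ν]
  (h : ∀ a, ρ (Iic a) ≤ ν (Iic a))
include h

theorem meas_Ioi_le_of_Iic_le (a : ℝ) : ν (Ioi a) ≤ ρ (Ioi a) := by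
  rw [← compl_Iic, prob_compl_eq_one_sub measurableSet_Iic, prob_compl_eq_one_sub measurableSet_Iic]
  exact tsub_le_tsub_left (h a) 1

theorem lintegral_pos_part_le : ∫⁻ x, ENNReal.ofReal x ∂ν ≤ ∫⁻ x, ENNReal.ofReal x ∂ρ := by
  rw [lintegral_ofReal_eq_meas_Ioi, lintegral_ofReal_eq_meas_Ioi]
  exact lintegral_mono fun t => meas_Ioi_le_of_Iic_le h t

omit [IsProbabilityMeasure ρ] [IsProbabilityMeasure ν] in
theorem lintegral_neg_part_le : ∫⁻ x, ENNReal.ofReal (-x) ∂ρ ≤ ∫⁻ x, ENNReal.ofReal (-x) ∂ν := by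
  rw [lintegral_ofReal_neg_eq_meas_Iic, lintegral_ofReal_neg_eq_meas_Iic]
  exact lintegral_mono fun t => h _

theorem extExp_le_of_Iic_le : extExp ν (fun x => x) ≤ extExp ρ (fun x => x) :=
  EReal.sub_le_sub (EReal.coe_ennreal_le_coe_ennreal_iff.2 (lintegral_pos_part_le h))
    (EReal.coe_ennreal_le_coe_ennreal_iff.2 (lintegral_neg_part_le h))

/-- Stochastically ordered laws with the same positive and negative parts of the mean agree. -/
theorem eq_of_lintegral_eq (hpos : ∫⁻ x, ENNReal.ofReal x ∂ρ = ∫⁻ x, ENNReal.ofReal x ∂ν)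
    (hneg : ∫⁻ x, ENNReal.ofReal (-x) ∂ρ = ∫⁻ x, ENNReal.ofReal (-x) ∂ν)
    (hpos' : ∫⁻ x, ENNReal.ofReal x ∂ν ≠ ∞) (hneg' : ∫⁻ x, ENNReal.ofReal (-x) ∂ν ≠ ∞) :
    ρ = ν := by
  have hIoi : ∀ᵐ t : ℝ, t ∈ Ioi 0 → ρ (Iic t) = ν (Iic t) := by
    rw [lintegral_ofReal_eq_meas_Ioi, lintegral_ofReal_eq_meas_Ioi] at hpos
    rw [lintegral_ofReal_eq_meas_Ioi] at hpos'
    have hm : Antitone fun t => ρ (Ioi t) := fun a b hab => measure_mono (Ioi_subset_Ioi hab)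
    have := ae_eq_of_ae_le_of_lintegral_le
      (Eventually.of_forall fun t => meas_Ioi_le_of_Iic_le h t) hpos'
      hm.measurable.aemeasurable hpos.le
    filter_upwards [(ae_restrict_iff' measurableSet_Ioi).1 this] with t ht ht0
    rw [← compl_Ioi, prob_compl_eq_one_sub measurableSet_Ioi,
      prob_compl_eq_one_sub measurableSet_Ioi, ht ht0]
  have hIio : ∀ᵐ t : ℝ, t ∈ Iio 0 → ρ (Iic t) = ν (Iic t) := by
    rw [lintegral_ofReal_neg_eq_meas_Iic, lintegral_ofReal_neg_eq_meas_Iic] at hneg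
    rw [lintegral_ofReal_neg_eq_meas_Iic] at hneg'
    have hm : Antitone fun t => ν (Iic (-t)) := fun a b hab =>
      measure_mono (Iic_subset_Iic.2 (neg_le_neg hab))
    have := ae_eq_of_ae_le_of_lintegral_le (μ := volume.restrict (Ioi 0))
      (Eventually.of_forall fun t : ℝ => h (-t)) (hneg ▸ hneg')
      hm.measurable.aemeasurable hneg.ge
    have h2 := (ae_restrict_iff' measurableSet_Ioi).1 this
    filter_upwards [(Measure.measurePreserving_neg (volume : Measure ℝ)).quasiMeasurePreserving.ae
      h2] with t ht ht0
    simpa using ht (by simpa using ht0)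
  have hall : ∀ᵐ t : ℝ, ρ (Iic t) = ν (Iic t) := by
    have h0 : ∀ᵐ t : ℝ, t ≠ 0 := by simp [ae_iff]
    filter_upwards [hIoi, hIio, h0] with t h1 h2 h3
    exact h3.lt_or_gt.elim h2 h1
  refine Measure.ext_of_Iic _ _ fun a => le_antisymm (h a) ?_
  have hfreq : ∃ᶠ b in 𝓝[>] a, ρ (Iic b) = ν (Iic b) := by
    intro hcon
    obtain ⟨c, hc, hsub⟩ := mem_nhdsGT_iff_exists_Ioo_subset.1 hcon
    have h0 := measure_mono_null hsub (ae_iff.1 hall)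
    rw [Real.volume_Ioo, ENNReal.ofReal_eq_zero] at h0
    exact absurd (mem_Ioi.1 hc) (not_lt.2 (by linarith))
  have hlim : Tendsto (fun b => ρ (Iic b)) (𝓝[>] a) (𝓝 (ρ (Iic a))) := by
    simp only [← ofReal_cdf]
    exact (ENNReal.continuous_ofReal.tendsto _).comp
      (((cdf ρ).right_continuous a).mono_left (nhdsWithin_mono _ Ioi_subset_Ici_self))
  refine ge_of_tendsto_of_frequently hlim ?_
  refine (hfreq.and_eventually self_mem_nhdsWithin).mono fun b hb => ?_
  rw [hb.1]
  exact measure_mono (Iic_subset_Iic.2 (le_of_lt hb.2))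

/-- Stochastically ordered laws with finite means in the wrong order agree. -/
theorem eq_of_extExp_le (hle : extExp ρ (fun x => x) ≤ extExp ν (fun x => x))
    (hpos' : ∫⁻ x, ENNReal.ofReal x ∂ν ≠ ∞) (hneg' : ∫⁻ x, ENNReal.ofReal (-x) ∂ν ≠ ∞) :
    ρ = ν := by
  have h1 := lintegral_pos_part_le h
  have h2 := lintegral_neg_part_le h
  suffices hs : ∫⁻ x, ENNReal.ofReal x ∂ρ = ∫⁻ x, ENNReal.ofReal x ∂ν ∧
      ∫⁻ x, ENNReal.ofReal (-x) ∂ρ = ∫⁻ x, ENNReal.ofReal (-x) ∂ν from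
    eq_of_lintegral_eq h hs.1 hs.2 hpos' hneg'
  unfold extExp at hle
  have h3 := (h2.trans_lt hneg'.lt_top).ne
  generalize ∫⁻ x, ENNReal.ofReal x ∂ρ = a at *
  generalize ∫⁻ x, ENNReal.ofReal x ∂ν = b at *
  generalize ∫⁻ x, ENNReal.ofReal (-x) ∂ρ = c at *
  generalize ∫⁻ x, ENNReal.ofReal (-x) ∂ν = d at *
  lift b to ℝ≥0 using hpos'
  lift c to ℝ≥0 using h3
  lift d to ℝ≥0 using hneg'
  induction a with
  | top =>
    exfalso
    simp only [EReal.coe_ennreal_top, EReal.coe_nnreal_eq_coe_real] at hle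
    rw [← EReal.coe_sub, EReal.top_sub_coe, top_le_iff] at hle
    exact EReal.coe_ne_top _ hle
  | coe a =>
    simp only [EReal.coe_nnreal_eq_coe_real] at hle
    rw [← EReal.coe_sub, ← EReal.coe_sub, EReal.coe_le_coe_iff] at hle
    have h1' : (b : ℝ) ≤ a := by exact_mod_cast h1
    have h2' : (c : ℝ) ≤ d := by exact_mod_cast h2
    constructor
    · have : (a : ℝ) = b := by linarith
      exact_mod_cast this
    · have : (c : ℝ) = d := by linarith
      exact_mod_cast this

end Law

/-! ### The distorted law and the extreme measure -/

theorem distortedLaw_Iic {ψ : ConcaveDistortion}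
    (h0 : Tendsto (fun x : ℝ => ψ x) (𝓝[>] 0) (𝓝 0)) (μ : Measure ℝ) (a : ℝ) :
    distortedLaw ψ μ (Iic a) = ENNReal.ofReal (ψ (cdf μ a)) := by
  have hc := ψ.continuousOn h0
  have hmem : ∀ x, cdf μ x ∈ Icc (0 : ℝ) 1 := fun x => ⟨cdf_nonneg μ x, cdf_le_one μ x⟩
  have hval : ∀ x, (ψ.monotone_comp_cdf μ).stieltjesFunction x = ψ (cdf μ x) := by
    intro x
    rw [Monotone.stieltjesFunction_eq]
    refine ContinuousWithinAt.rightLim_eq ?_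
    exact ContinuousWithinAt.comp (t := Icc 0 1) (hc _ (hmem x)) ((cdf μ).right_continuous x)
      fun y _ => hmem y
  have hbot : Tendsto (ψ.monotone_comp_cdf μ).stieltjesFunction atBot (𝓝 0) := by
    have h1 : Tendsto (fun x => ψ (cdf μ x)) atBot (𝓝 (ψ 0)) :=
      (hc 0 ⟨le_rfl, zero_le_one⟩).tendsto.comp
        (tendsto_nhdsWithin_iff.2 ⟨tendsto_cdf_atBot μ, Eventually.of_forall hmem⟩)
    rw [ψ.map_zero] at h1
    exact h1.congr fun x => (hval x).symm
  rw [distortedLaw, StieltjesFunction.measure_Iic _ hbot, hval, sub_zero]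

theorem isProbabilityMeasure_distortedLaw {ψ : ConcaveDistortion}
    (h0 : Tendsto (fun x : ℝ => ψ x) (𝓝[>] 0) (𝓝 0)) (μ : Measure ℝ) :
    IsProbabilityMeasure (distortedLaw ψ μ) := by
  have hc := ψ.continuousOn h0
  have h1 := tendsto_measure_iUnion_atTop (μ := distortedLaw ψ μ)
    (fun a b hab => Iic_subset_Iic.2 hab : Monotone (Iic : ℝ → Set ℝ))
  rw [iUnion_Iic] at h1
  have h2 : Tendsto (fun x => ENNReal.ofReal (ψ (cdf μ x))) atTop (𝓝 (ENNReal.ofReal (ψ 1))) :=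
    (ENNReal.continuous_ofReal.tendsto _).comp
      ((hc 1 ⟨zero_le_one, le_rfl⟩).tendsto.comp (tendsto_nhdsWithin_iff.2
        ⟨tendsto_cdf_atTop μ, Eventually.of_forall fun x => ⟨cdf_nonneg μ x, cdf_le_one μ x⟩⟩))
  rw [ψ.map_one, ENNReal.ofReal_one] at h2
  exact ⟨tendsto_nhds_unique (h1.congr fun x => distortedLaw_Iic h0 μ x) h2⟩

section Extreme

variable {Ω : Type*} [MeasurableSpace Ω] {P : Measure Ω} [IsProbabilityMeasure P]

/-- The measure with density `ψ'(D_X(X))`, where `D_X` is the distribution function of `X`. -/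
noncomputable def extremeMeasure (P : Measure Ω) (ψ : ConcaveDistortion) (X : Ω → ℝ) : Measure Ω :=
  P.withDensity fun ω => ENNReal.ofReal (ψ.rightSlope (cdf (P.map X) (X ω)))

variable {ψ : ConcaveDistortion} (h0 : Tendsto (fun x : ℝ => ψ x) (𝓝[>] 0) (𝓝 0))
  {X : Ω → ℝ} (hX : Measurable X) (hc : Continuous (cdf (P.map X)))

include hX hc in
theorem map_cdf_comp_eq_uniform :
    P.map (fun ω => cdf (P.map X) (X ω)) = volume.restrict (Ioo 0 1) := by
  have : IsProbabilityMeasure (P.map X) := Measure.isProbabilityMeasure_map hX.aemeasurable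
  rw [← map_cdf_eq_uniform (P.map X) hc, Measure.map_map hc.measurable hX]
  rfl

include h0 hX hc in
theorem extremeMeasure_apply_le {p : ℝ} (hp : p ∈ Icc (0 : ℝ) 1) :
    extremeMeasure P ψ X {ω | cdf (P.map X) (X ω) ≤ p} = ENNReal.ofReal (ψ p) := by
  have hU : Measurable fun ω => cdf (P.map X) (X ω) := hc.measurable.comp hX
  have hk : Measurable fun u => ENNReal.ofReal (ψ.rightSlope u) :=
    ψ.measurable_rightSlope.ennreal_ofReal
  have hset : (Iic p ∩ Ioo 0 1 : Set ℝ) =ᵐ[volume] Ioo 0 p := by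
    have h1 : (Iio p ∩ Ioo 0 1 : Set ℝ) = Ioo 0 p := by
      ext x
      exact ⟨fun h => ⟨h.2.1, h.1⟩, fun h => ⟨h.2, h.1, h.2.trans_le hp.2⟩⟩
    rw [← h1]
    exact Iio_ae_eq_Iic.symm.inter (ae_eq_refl _)
  rw [extremeMeasure, withDensity_apply _ (measurableSet_le hU measurable_const)]
  change ∫⁻ ω in (fun ω => cdf (P.map X) (X ω)) ⁻¹' Iic p, _ ∂P = _
  rw [← setLIntegral_map measurableSet_Iic hk hU, map_cdf_comp_eq_uniform hX hc,
    Measure.restrict_restrict measurableSet_Iic, setLIntegral_congr hset,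
    ψ.lintegral_rightSlope h0 hp]

include h0 hX hc in
theorem isProbabilityMeasure_extremeMeasure : IsProbabilityMeasure (extremeMeasure P ψ X) := by
  have h := extremeMeasure_apply_le h0 hX hc (p := 1) ⟨zero_le_one, le_rfl⟩
  rw [ψ.map_one, ENNReal.ofReal_one] at h
  refine ⟨?_⟩
  rw [← h]
  congr 1
  ext ω
  simp [cdf_le_one]

include h0 hX hc in
theorem extremeMeasure_mem_determiningSet : extremeMeasure P ψ X ∈ determiningSet P ψ := by
  have hU : Measurable fun ω => cdf (P.map X) (X ω) := hc.measurable.comp hX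
  have hk : Measurable fun u => ENNReal.ofReal (ψ.rightSlope u) :=
    ψ.measurable_rightSlope.ennreal_ofReal
  refine ⟨isProbabilityMeasure_extremeMeasure h0 hX hc, withDensity_absolutelyContinuous _ _,
    fun x hx => ?_⟩
  obtain ⟨p, hp, hconj, hmax⟩ := ψ.exists_conjugate_eq h0 x
  set c := ENNReal.ofReal x with hcdef
  have hright : ∫⁻ u in Ico p 1, (ENNReal.ofReal (ψ.rightSlope u) - c) = 0 := by
    rw [← setLIntegral_congr Ioo_ae_eq_Ico,
      setLIntegral_eq_zero_iff measurableSet_Ioo (hk.sub_const c)]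
    refine Eventually.of_forall fun u hu => tsub_eq_zero_iff_le.2 (ENNReal.ofReal_le_ofReal ?_)
    exact ψ.rightSlope_le_of_lt hp hmax ⟨hp.1.trans_lt hu.1, hu.2⟩ hu.1
  have hleft : ∫⁻ u in Ioo 0 p, (ENNReal.ofReal (ψ.rightSlope u) - c)
      = ENNReal.ofReal (ψ p - x * p) := by
    rw [lintegral_sub measurable_const, ψ.lintegral_rightSlope h0 hp, setLIntegral_const,
      Real.volume_Ioo, sub_zero, hcdef, ← ENNReal.ofReal_mul hx,
      ENNReal.ofReal_sub _ (mul_nonneg hx hp.1)]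
    · rw [setLIntegral_const, Real.volume_Ioo]
      exact ENNReal.mul_ne_top ENNReal.ofReal_ne_top ENNReal.ofReal_ne_top
    · filter_upwards [ae_restrict_mem measurableSet_Ioo] with u hu
      exact ENNReal.ofReal_le_ofReal
        (ψ.le_rightSlope_of_lt hp hmax ⟨hu.1, hu.2.trans_le hp.2⟩ hu.2)
  calc ∫⁻ ω, ((extremeMeasure P ψ X).rnDeriv P ω - c) ∂P
      = ∫⁻ ω, (ENNReal.ofReal (ψ.rightSlope (cdf (P.map X) (X ω))) - c) ∂P := by
        refine lintegral_congr_ae ?_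
        filter_upwards [Measure.rnDeriv_withDensity P (hk.comp hU)] with ω hω
        simp only [Function.comp_def] at hω
        rw [extremeMeasure, hω]
    _ = ∫⁻ u in Ioo 0 1, (ENNReal.ofReal (ψ.rightSlope u) - c) := by
        rw [← map_cdf_comp_eq_uniform hX hc, lintegral_map (hk.sub_const c) hU]
    _ ≤ ∫⁻ u in Ioo 0 p ∪ Ico p 1, (ENNReal.ofReal (ψ.rightSlope u) - c) := by
        refine lintegral_mono_set fun u hu => ?_
        exact (lt_or_ge u p).imp (fun h => ⟨hu.1, h⟩) (fun h => ⟨h, hu.2⟩)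
    _ ≤ (∫⁻ u in Ioo 0 p, (ENNReal.ofReal (ψ.rightSlope u) - c))
        + ∫⁻ u in Ico p 1, (ENNReal.ofReal (ψ.rightSlope u) - c) := lintegral_union_le _ _ _
    _ = ENNReal.ofReal (conjugate ψ x) := by rw [hleft, hright, add_zero, hconj]

include h0 hX hc in
theorem map_extremeMeasure : (extremeMeasure P ψ X).map X = distortedLaw ψ (P.map X) := by
  have : IsProbabilityMeasure (P.map X) := Measure.isProbabilityMeasure_map hX.aemeasurable
  have := isProbabilityMeasure_extremeMeasure (P := P) h0 hX hc
  have := Measure.isProbabilityMeasure_map (μ := extremeMeasure P ψ X) hX.aemeasurable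
  have hU : Measurable fun ω => cdf (P.map X) (X ω) := hc.measurable.comp hX
  refine Measure.ext_of_Iic _ _ fun a => ?_
  have hmem : cdf (P.map X) a ∈ Icc (0 : ℝ) 1 := ⟨cdf_nonneg _ a, cdf_le_one _ a⟩
  rw [distortedLaw_Iic h0, ← extremeMeasure_apply_le h0 hX hc hmem,
    Measure.map_apply hX measurableSet_Iic]
  -- The two sets differ by a plateau of the distribution function, which is null because `D_X(X)`
  -- is uniform.
  have hae : X ⁻¹' Iic a =ᵐ[P] {ω | cdf (P.map X) (X ω) ≤ cdf (P.map X) a} := by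
    refine ae_eq_of_subset_of_measure_ge (fun ω hω => monotone_cdf _ hω) ?_
      (hX measurableSet_Iic).nullMeasurableSet (measure_ne_top _ _)
    have h1 : P {ω | cdf (P.map X) (X ω) ≤ cdf (P.map X) a}
        = P.map (fun ω => cdf (P.map X) (X ω)) (Iic (cdf (P.map X) a)) :=
      (Measure.map_apply hU measurableSet_Iic).symm
    rw [h1, map_cdf_comp_eq_uniform hX hc, Measure.restrict_apply measurableSet_Iic,
      ← Measure.map_apply hX measurableSet_Iic, ← ofReal_cdf]
    refine (measure_mono (t := Ioc 0 (cdf (P.map X) a)) fun u hu => ⟨hu.2.1, hu.1⟩).trans ?_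
    rw [Real.volume_Ioc, sub_zero]
  exact measure_congr ((withDensity_absolutelyContinuous _ _).ae_eq hae)

include h0 hX hc in
/-- Every measure giving `X` the distorted law attains the distorted probability along a common
family of sets. -/
theorem exists_attain {p : ℝ} (hp : p ∈ Icc (0 : ℝ) 1) :
    ∃ A, MeasurableSet A ∧ P A = ENNReal.ofReal p ∧ ∀ Q : Measure Ω, IsProbabilityMeasure Q →
      Q.map X = distortedLaw ψ (P.map X) → Q A = ENNReal.ofReal (ψ p) := by
  have : IsProbabilityMeasure (P.map X) := Measure.isProbabilityMeasure_map hX.aemeasurable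
  -- The distribution function need not attain `0` or `1`, so the endpoints use `∅` and `univ`.
  rcases hp.1.eq_or_lt with rfl | hp0
  · exact ⟨∅, MeasurableSet.empty, by simp, fun Q _ _ => by simp [ψ.map_zero]⟩
  rcases hp.2.eq_or_lt with rfl | hp1
  · exact ⟨univ, MeasurableSet.univ, by simp, fun Q _ _ => by simp [ψ.map_one]⟩
  obtain ⟨a, rfl⟩ : ∃ a, cdf (P.map X) a = p := mem_range_of_exists_le_of_exists_ge hc
    ((tendsto_cdf_atBot _).eventually_le_const hp0).exists
    ((tendsto_cdf_atTop _).eventually_const_le hp1).exists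
  refine ⟨X ⁻¹' Iic a, hX measurableSet_Iic, ?_, fun Q _ hQ => ?_⟩
  · rw [ofReal_cdf, Measure.map_apply hX measurableSet_Iic]
  · rw [← distortedLaw_Iic h0, ← hQ, Measure.map_apply hX measurableSet_Iic]

include h0 hX in
theorem map_Iic_le_distortedLaw {Q : Measure Ω} (hQ : Q ∈ determiningSet P ψ) (a : ℝ) :
    Q.map X (Iic a) ≤ distortedLaw ψ (P.map X) (Iic a) := by
  have : IsProbabilityMeasure (P.map X) := Measure.isProbabilityMeasure_map hX.aemeasurable
  rw [distortedLaw_Iic h0, Measure.map_apply hX measurableSet_Iic, cdf_eq_real,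
    map_measureReal_apply hX measurableSet_Iic]
  exact measure_le_of_mem_determiningSet hQ (hX measurableSet_Iic)

include h0 hX hc in
theorem extremeMeasure_mem_extremeMeasures : extremeMeasure P ψ X ∈ extremeMeasures P ψ X := by
  refine ⟨extremeMeasure_mem_determiningSet h0 hX hc, fun Q hQ => ?_⟩
  have := hQ.1
  have := isProbabilityMeasure_distortedLaw h0 (P.map X)
  have := Measure.isProbabilityMeasure_map (μ := Q) hX.aemeasurable
  rw [← extExp_map _ hX, ← extExp_map _ hX, map_extremeMeasure h0 hX hc]
  exact extExp_le_of_Iic_le (map_Iic_le_distortedLaw h0 hX hQ)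

include h0 hX hc in
/-- Extreme measures give `X` the distorted law. -/
theorem map_eq_distortedLaw_of_mem_extremeMeasures
    (hpos : ∫⁻ x, ENNReal.ofReal x ∂(P.map X) ≠ ∞)
    (hneg : ∫⁻ x, ENNReal.ofReal (-x) ∂(distortedLaw ψ (P.map X)) ≠ ∞)
    {Q : Measure Ω} (hQ : Q ∈ extremeMeasures P ψ X) :
    Q.map X = distortedLaw ψ (P.map X) := by
  have := hQ.1.1
  have := isProbabilityMeasure_distortedLaw h0 (P.map X)
  have := Measure.isProbabilityMeasure_map (μ := Q) hX.aemeasurable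
  have : IsProbabilityMeasure (P.map X) := Measure.isProbabilityMeasure_map hX.aemeasurable
  refine eq_of_extExp_le (map_Iic_le_distortedLaw h0 hX hQ.1) ?_ ?_ hneg
  · rw [← map_extremeMeasure h0 hX hc, extExp_map _ hX, extExp_map _ hX]
    exact hQ.2 _ (extremeMeasure_mem_determiningSet h0 hX hc)
  · refine ne_top_of_le_ne_top hpos (lintegral_pos_part_le fun a => ?_)
    rw [distortedLaw_Iic h0, ← ofReal_cdf]
    exact ENNReal.ofReal_le_ofReal (ψ.le_map ⟨cdf_nonneg _ a, cdf_le_one _ a⟩)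

include h0 hX hc in
theorem eq_extremeMeasure_of_map_eq {Q : Measure Ω} (hQ : Q ∈ determiningSet P ψ)
    (hmap : Q.map X = distortedLaw ψ (P.map X)) : Q = extremeMeasure P ψ X := by
  refine eq_of_attain h0 hQ (extremeMeasure_mem_determiningSet h0 hX hc) fun p hp => ?_
  obtain ⟨A, hA, hPA, hattain⟩ := exists_attain h0 hX hc hp
  exact ⟨A, hA, hPA, hattain Q hQ.1 hmap, hattain _ (isProbabilityMeasure_extremeMeasure h0 hX hc)
    (map_extremeMeasure h0 hX hc)⟩

end Extreme
-- A continuously distributed variable on an atomless space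
section Atomless

variable {Ω : Type*} [MeasurableSpace Ω] {P : Measure Ω} [IsProbabilityMeasure P]

/-- Repeated halving: when a set is split in two, one piece has at most half of the mass. -/
theorem Atomless.exists_subset_le (hP : Atomless P) {A : Set Ω} (hA : MeasurableSet A)
    (hA0 : 0 < P A) {ε : ℝ≥0∞} (hε : 0 < ε) :
    ∃ B, MeasurableSet B ∧ B ⊆ A ∧ 0 < P B ∧ P B ≤ ε := by
  have key : ∀ n : ℕ, ∃ B, MeasurableSet B ∧ B ⊆ A ∧ 0 < P B ∧ P B ≤ 2⁻¹ ^ n := by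
    intro n
    induction n with
    | zero => exact ⟨A, hA, Subset.rfl, hA0, by simpa using prob_le_one⟩
    | succ n ih =>
      obtain ⟨B, hB, hBA, hB0, hBn⟩ := ih
      obtain ⟨C, hC, hCB, hC0, hCB'⟩ := hP B hB hB0
      have hadd : P C + P (B \ C) = P B := by
        rw [measure_sdiff hCB hC.nullMeasurableSet (measure_ne_top _ _), add_tsub_cancel_of_le hCB'.le]
      by_cases hCn : P C ≤ 2⁻¹ ^ (n + 1)
      · exact ⟨C, hC, hCB.trans hBA, hC0, hCn⟩
      refine ⟨B \ C, hB.diff hC, sdiff_subset.trans hBA, ?_, ?_⟩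
      · rw [pos_iff_ne_zero]
        intro h
        rw [h, add_zero] at hadd
        exact hCB'.ne hadd
      · by_contra! hlt
        have h1 := ENNReal.add_lt_add (not_le.1 hCn) hlt
        rw [hadd, pow_succ, ← mul_add, ENNReal.inv_two_add_inv_two, mul_one] at h1
        exact absurd hBn (not_le.2 h1)
  obtain ⟨n, hn⟩ := ENNReal.exists_inv_two_pow_lt hε.ne'
  obtain ⟨B, hB, hBA, hB0, hBn⟩ := key n
  exact ⟨B, hB, hBA, hB0, hBn.trans hn.le⟩

/-- An atomless space is covered, up to a null set, by countably many small sets. -/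
theorem Atomless.exists_cover (hP : Atomless P) {ε : ℝ≥0∞} (hε : 0 < ε) :
    ∃ B : ℕ → Set Ω, (∀ n, MeasurableSet (B n) ∧ P (B n) ≤ ε) ∧ P (⋃ n, B n)ᶜ = 0 := by
  set S : Set ℝ≥0∞ := (fun B : ℕ → Set Ω => P (⋃ n, B n)) ''
    {B | ∀ n, MeasurableSet (B n) ∧ P (B n) ≤ ε} with hS
  have hne : S.Nonempty := ⟨_, fun _ => ∅, fun _ => ⟨MeasurableSet.empty, by simp⟩, rfl⟩
  -- Merging a maximising sequence of families attains the supremum; a remainder of positive mass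
  -- would contain a small set that raises it.
  obtain ⟨u, -, hu, huS⟩ := exists_seq_tendsto_sSup hne (OrderTop.bddAbove S)
  choose B hB hBu using huS
  set B' : ℕ → Set Ω := fun n => B n.unpair.1 n.unpair.2 with hB'
  have hB'mem : ∀ n, MeasurableSet (B' n) ∧ P (B' n) ≤ ε := fun n => hB _ _
  have hle : sSup S ≤ P (⋃ n, B' n) := by
    refine le_of_tendsto' hu fun k => ?_
    rw [← hBu k]
    refine measure_mono (iUnion_subset fun n => ?_)
    have : B k n = B' (Nat.pair k n) := by simp [hB']
    rw [this]
    exact subset_iUnion B' _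
  refine ⟨B', hB'mem, ?_⟩
  by_contra hne0
  have hUm : MeasurableSet (⋃ n, B' n) := MeasurableSet.iUnion fun n => (hB'mem n).1
  obtain ⟨C, hC, hCsub, hC0, hCε⟩ :=
    hP.exists_subset_le hUm.compl (pos_iff_ne_zero.2 hne0) hε
  set B'' : ℕ → Set Ω := fun n => Nat.casesOn n C B' with hB''
  have hmem : P (⋃ n, B'' n) ∈ S := by
    refine ⟨B'', fun n => ?_, rfl⟩
    cases n with
    | zero => exact ⟨hC, hCε⟩
    | succ n => exact hB'mem n
  have hunion : (⋃ n, B' n) ∪ C ⊆ ⋃ n, B'' n :=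
    union_subset (iUnion_subset fun n => subset_iUnion B'' (n + 1)) (subset_iUnion B'' 0)
  have h1 : P (⋃ n, B' n) + P C ≤ P (⋃ n, B' n) + 0 := by
    rw [← measure_union (disjoint_left.2 fun ω h1 h2 => hCsub h2 h1) hC, add_zero]
    exact (measure_mono hunion).trans ((le_sSup hmem).trans hle)
  exact hC0.ne' (le_antisymm ((ENNReal.add_le_add_iff_left (measure_ne_top _ _)).1 h1) zero_le)

theorem continuous_cdf_of_forall_singleton (μ : Measure ℝ) [IsProbabilityMeasure μ]
    (h : ∀ c, μ {c} = 0) : Continuous (cdf μ) := by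
  refine continuous_iff_continuousAt.2 fun c => ?_
  rw [(monotone_cdf μ).continuousAt_iff_leftLim_eq_rightLim, StieltjesFunction.rightLim_eq]
  have h1 := h c
  rw [← measure_cdf μ, StieltjesFunction.measure_singleton, ENNReal.ofReal_eq_zero] at h1
  exact le_antisymm ((monotone_cdf μ).leftLim_le le_rfl) (by linarith)

/-- On an atomless space there is a bounded random variable with a continuous distribution. -/
theorem Atomless.exists_bounded_continuous_cdf (hP : Atomless P) :
    ∃ X : Ω → ℝ, Measurable X ∧ (∀ ω, |X ω| < 2) ∧ Continuous (cdf (P.map X)) := by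
  have hpos : ∀ m : ℕ, (0 : ℝ≥0∞) < (m : ℝ≥0∞)⁻¹ := fun m =>
    ENNReal.inv_pos.2 (ENNReal.natCast_ne_top m)
  choose B hB hB0 using fun m : ℕ => hP.exists_cover (hpos m)
  -- A fibre of `F` lies, for each `m`, in one set `B m n` of mass at most `1/m` or in a null set,
  -- so it is null. An injective code into `ℝ` followed by `arctan` keeps the fibres and makes the
  -- variable bounded.
  set F : Ω → (ℕ × ℕ → ℝ) := fun ω i => (B i.1 i.2).indicator 1 ω with hF
  have hFm : Measurable F :=
    measurable_pi_lambda _ fun i => measurable_one.indicator (hB i.1 i.2).1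
  have hemb := measurableEmbedding_embeddingReal (ℕ × ℕ → ℝ)
  set X : Ω → ℝ := fun ω => Real.arctan (embeddingReal _ (F ω)) with hX
  have hXm : Measurable X := Real.measurable_arctan.comp (hemb.measurable.comp hFm)
  have : IsProbabilityMeasure (P.map X) := Measure.isProbabilityMeasure_map hXm.aemeasurable
  refine ⟨X, hXm, fun ω => ?_, continuous_cdf_of_forall_singleton _ fun c => ?_⟩
  · have h1 := Real.arctan_lt_pi_div_two (embeddingReal _ (F ω))
    have h2 := Real.neg_pi_div_two_lt_arctan (embeddingReal _ (F ω))
    have h3 := Real.pi_le_four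
    exact abs_lt.2 ⟨by linarith, by linarith⟩
  · rw [Measure.map_apply hXm (measurableSet_singleton c)]
    rcases (X ⁻¹' {c}).eq_empty_or_nonempty with h | ⟨ω₀, hω₀⟩
    · simp [h]
    have hfib : ∀ ω ∈ X ⁻¹' {c}, F ω = F ω₀ := fun ω hω =>
      hemb.injective (Real.arctan_injective (Eq.trans hω (Eq.symm hω₀)))
    have hiff : ∀ ω ∈ X ⁻¹' {c}, ∀ m n, ω ∈ B m n ↔ ω₀ ∈ B m n := by
      intro ω hω m n
      have := congrFun (hfib ω hω) (m, n)
      simp only [hF] at this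
      by_cases h1 : ω ∈ B m n <;> by_cases h2 : ω₀ ∈ B m n <;> simp [h1, h2] at this ⊢
    refine le_antisymm (ge_of_tendsto' ENNReal.tendsto_inv_nat_nhds_zero fun m => ?_) zero_le
    by_cases hm : ∃ n, ω₀ ∈ B m n
    · obtain ⟨n, hn⟩ := hm
      exact (measure_mono fun ω hω => (hiff ω hω m n).2 hn).trans (hB m n).2
    · push Not at hm
      refine (measure_mono fun ω hω => ?_).trans ((hB0 m).le.trans zero_le)
      simp only [mem_compl_iff, mem_iUnion, not_exists]
      exact fun n hn => hm n ((hiff ω hω m n).1 hn)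

end Atomless

/-- By the convention `∞ - ∞ = -∞` the positive part plays no role. -/
theorem bot_lt_extExp_iff {Ω : Type*} [MeasurableSpace Ω] {Q : Measure Ω} {X : Ω → ℝ} :
    ⊥ < extExp Q X ↔ ∫⁻ ω, ENNReal.ofReal (-X ω) ∂Q ≠ ∞ := by
  unfold extExp
  generalize ∫⁻ ω, ENNReal.ofReal (X ω) ∂Q = a
  generalize ∫⁻ ω, ENNReal.ofReal (-X ω) ∂Q = b
  constructor
  · rintro h rfl
    simp at h
  · intro h
    lift b to ℝ≥0 using h
    rw [bot_lt_iff_ne_bot, EReal.coe_nnreal_eq_coe_real]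
    induction a with
    | top => simp
    | coe a =>
      rw [EReal.coe_nnreal_eq_coe_real, ← EReal.coe_sub]
      exact EReal.coe_ne_bot _

/-! ### Membership in `L1Index`, uniqueness, and unbounded densities -/

section Main

variable {Ω : Type*} [MeasurableSpace Ω] {P : Measure Ω} [IsProbabilityMeasure P]

theorem bot_lt_distortedExp_of_bounded {ψ : ConcaveDistortion}
    (h0 : Tendsto (fun x : ℝ => ψ x) (𝓝[>] 0) (𝓝 0)) {X : Ω → ℝ} (hX : Measurable X) {M : ℝ}
    (hM : ∀ ω, |X ω| < M) : ⊥ < distortedExp P ψ X := by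
  have : IsProbabilityMeasure (P.map X) := Measure.isProbabilityMeasure_map hX.aemeasurable
  have := isProbabilityMeasure_distortedLaw h0 (P.map X)
  rw [distortedExp, bot_lt_extExp_iff, lintegral_ofReal_neg_eq_meas_Iic]
  have hle : ∀ t ∈ Ioi (0 : ℝ),
      distortedLaw ψ (P.map X) (Iic (-t)) ≤ (Ioo 0 M).indicator (fun _ => 1) t := by
    intro t ht
    by_cases htM : t < M
    · rw [indicator_of_mem (show t ∈ Ioo 0 M from ⟨ht, htM⟩)]
      exact prob_le_one
    · have hempty : X ⁻¹' Iic (-t) = ∅ := by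
        ext ω
        have := (abs_lt.1 (hM ω)).1
        simp only [mem_preimage, mem_Iic, mem_empty_iff_false, iff_false, not_le]
        linarith
      rw [distortedLaw_Iic h0, cdf_eq_real, map_measureReal_apply hX measurableSet_Iic, hempty,
        measureReal_empty, ψ.map_zero, ENNReal.ofReal_zero]
      exact zero_le
  refine ne_top_of_le_ne_top ?_ (setLIntegral_mono' measurableSet_Ioi hle)
  refine ne_top_of_le_ne_top ?_ (setLIntegral_le_lintegral _ _)
  rw [lintegral_indicator_const measurableSet_Ioo, one_mul, Real.volume_Ioo]
  exact ENNReal.ofReal_ne_top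

theorem mem_L1Index_of_bounded {Ψ : ℝ≥0 → ConcaveDistortion}
    (hzero : ∀ t : ℝ≥0, Tendsto (fun x : ℝ => Ψ t x) (𝓝[>] 0) (𝓝 0)) {X : Ω → ℝ}
    (hX : Measurable X) {M : ℝ} (hM : ∀ ω, |X ω| < M) : X ∈ L1Index P Ψ :=
  ⟨hX, fun t => ⟨bot_lt_distortedExp_of_bounded (hzero t) hX hM,
    bot_lt_distortedExp_of_bounded (hzero t) hX.neg fun ω => by simpa using hM ω⟩⟩

/-- At `t = 0` the distortion is the identity, so the condition on `-X` is integrability of `X⁺`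
under `P`. -/
theorem lintegral_ne_top_of_mem_L1Index {Ψ : ℝ≥0 → ConcaveDistortion}
    (hΨ : IsDistortionSemigroup Ψ)
    (hzero : ∀ t : ℝ≥0, Tendsto (fun x : ℝ => Ψ t x) (𝓝[>] 0) (𝓝 0)) {X : Ω → ℝ}
    (hX : X ∈ L1Index P Ψ) : ∫⁻ x, ENNReal.ofReal x ∂(P.map X) ≠ ∞ := by
  have hXm := hX.1
  have : IsProbabilityMeasure (P.map (-X)) := Measure.isProbabilityMeasure_map hXm.neg.aemeasurable
  have := isProbabilityMeasure_distortedLaw (hzero 0) (P.map (-X))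
  have hlaw : distortedLaw (Ψ 0) (P.map (-X)) = P.map (-X) := Measure.ext_of_Iic _ _ fun a => by
    rw [distortedLaw_Iic (hzero 0), hΨ.map_zero_time hzero ⟨cdf_nonneg _ a, cdf_le_one _ a⟩,
      ofReal_cdf]
  have h := (hX.2 0).2
  rw [distortedExp, hlaw, bot_lt_extExp_iff, lintegral_map (by fun_prop) hXm.neg] at h
  rw [lintegral_map (by fun_prop) hXm]
  simpa using h

theorem extremeMeasures_eq_singleton {Ψ : ℝ≥0 → ConcaveDistortion}
    (hΨ : IsDistortionSemigroup Ψ)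
    (hzero : ∀ t : ℝ≥0, Tendsto (fun x : ℝ => Ψ t x) (𝓝[>] 0) (𝓝 0)) {X : Ω → ℝ}
    (hX : X ∈ L1Index P Ψ) (hc : Continuous (cdf (P.map X))) (t : ℝ≥0) :
    extremeMeasures P (Ψ t) X = {extremeMeasure P (Ψ t) X} := by
  refine eq_singleton_iff_unique_mem.2
    ⟨extremeMeasure_mem_extremeMeasures (hzero t) hX.1 hc, fun Q hQ => ?_⟩
  exact eq_extremeMeasure_of_map_eq (hzero t) hX.1 hc hQ.1
    (map_eq_distortedLaw_of_mem_extremeMeasures (hzero t) hX.1 hc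
      (lintegral_ne_top_of_mem_L1Index hΨ hzero hX) (bot_lt_extExp_iff.1 (hX.2 t).1) hQ)

theorem unboundedDensity_extremeMeasure {ψ : ConcaveDistortion}
    (h0 : Tendsto (fun x : ℝ => ψ x) (𝓝[>] 0) (𝓝 0)) (hψ : RightDerivEqTop ψ 0) {X : Ω → ℝ}
    (hX : Measurable X) (hc : Continuous (cdf (P.map X))) :
    UnboundedDensity P (extremeMeasure P ψ X) := by
  have := isProbabilityMeasure_extremeMeasure (P := P) h0 hX hc
  refine unboundedDensity_of_attain hψ (withDensity_absolutelyContinuous _ _) fun p hp => ?_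
  obtain ⟨A, hA, hPA, hattain⟩ := exists_attain h0 hX hc hp
  exact ⟨A, hA, hPA, hattain _ this (map_extremeMeasure h0 hX hc)⟩

omit [IsProbabilityMeasure P] in
theorem rightDerivEqTop_of_unboundedDensity {ψ : ConcaveDistortion}
    {Q : Measure Ω} (hQ : Q ∈ determiningSet P ψ) (hunb : UnboundedDensity P Q) :
    RightDerivEqTop ψ 0 := by
  refine (ConcaveDistortion.rightDerivEqTop_or_bounded ψ ψ.map_zero fun x y hx hxy hy =>
    ψ.map_mul_le hx.le hxy hy.le).resolve_right ?_
  rintro ⟨C, hC, hle⟩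
  -- The maximum with `1` covers the endpoint `y = 1`, where the bound by `C` is not given.
  have hC' : C ≤ ((max C 1).toNNReal : ℝ) := by
    rw [Real.coe_toNNReal _ (by positivity)]; exact le_max_left _ _
  refine not_unboundedDensity_of_bounded (C := (max C 1).toNNReal) (fun y hy => ?_) hQ hunb
  rcases hy.1.eq_or_lt with rfl | hy0
  · simp [ψ.map_zero]
  rcases hy.2.eq_or_lt with rfl | hy1
  · rw [ψ.map_one, Real.coe_toNNReal _ (by positivity), mul_one]; exact le_max_right _ _
  · exact (hle y ⟨hy0, hy1⟩).trans (mul_le_mul_of_nonneg_right hC' hy.1)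

end Main
end DistortionSemigroups

theorem corollary2 {Ω : Type*} [MeasurableSpace Ω] (P : Measure Ω) [IsProbabilityMeasure P]
    (hP : DistortionSemigroups.Atomless P)
    (Ψ : ℝ≥0 → DistortionSemigroups.ConcaveDistortion)
    (hΨ : DistortionSemigroups.IsDistortionSemigroup Ψ)
    (hzero : ∀ t : ℝ≥0, Tendsto (fun x : ℝ => Ψ t x) (𝓝[>] 0) (𝓝 0)) :
    -- the limits that define the generator exist
    (∀ x ∈ Ioo (0 : ℝ) 1, Tendsto (fun t : ℝ≥0 => (Ψ t x - x) / (t : ℝ)) (𝓝[>] 0)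
      (𝓝 (DistortionSemigroups.generator Ψ x))) ∧
    -- the extreme measure exists and is unique
    (∀ X ∈ DistortionSemigroups.L1Index P Ψ, Continuous (cdf (P.map X)) → ∀ t : ℝ≥0, 0 < t →
      ∃! Q : Measure Ω, Q ∈ DistortionSemigroups.extremeMeasures P (Ψ t) X) ∧
    -- the equivalence
    List.TFAE [
      ∀ X ∈ DistortionSemigroups.L1Index P Ψ, Continuous (cdf (P.map X)) → ∀ t : ℝ≥0, 0 < t →
        ∀ Q ∈ DistortionSemigroups.extremeMeasures P (Ψ t) X,
          DistortionSemigroups.UnboundedDensity P Q,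
      ∀ t : ℝ≥0, 0 < t → DistortionSemigroups.RightDerivEqTop (Ψ t) 0,
      DistortionSemigroups.RightDerivEqTop (DistortionSemigroups.generator Ψ) 0] := by
  open DistortionSemigroups in
  refine ⟨fun x hx => hΨ.tendsto_generator hzero hx, fun X hX hc t _ => ?_, ?_⟩
  · rw [extremeMeasures_eq_singleton hΨ hzero hX hc t]
    exact ⟨_, rfl, fun Q hQ => hQ⟩
  · tfae_have 2 ↔ 3 := hΨ.rightDerivEqTop_iff hzero
    tfae_have 2 → 1 := by
      intro h X hX hc t ht Q hQ
      rw [extremeMeasures_eq_singleton hΨ hzero hX hc t] at hQ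
      rw [hQ]
      exact unboundedDensity_extremeMeasure (hzero t) (h t ht) hX.1 hc
    tfae_have 1 → 2 := by
      intro h t ht
      obtain ⟨X, hX, hM, hc⟩ := hP.exists_bounded_continuous_cdf
      exact rightDerivEqTop_of_unboundedDensity (extremeMeasure_mem_determiningSet (hzero t) hX hc)
        (h X (mem_L1Index_of_bounded hzero hX hM) hc t ht _
          (extremeMeasure_mem_extremeMeasures (hzero t) hX hc))
    tfae_finish
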